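/- Let $\mathbb{R}^p$ carry an inner product with norm $\|\cdot\|$. Let $G:\mathbb{R}^p\to\mathbb{R}^p$ have a zero, let $\mathrm{zer}\,G:=\{x: Gx=0\}$, and let $G$ be $\beta$-co-coercive for some $\beta>0$, i.e. $\langle Gx-Gy,x-y\rangle\ge\beta\|Gx-Gy\|^2$ for all $x,y$. Suppose that $G$ has an unbiased stochastic oracle $\mathbf{G}(\cdot,\xi)$ with variance bounded by $\sigma^2$: $\mathbb{E}_\xi[\mathbf{G}(x,\xi)]=Gx$ and $\mathbb{E}_\xi[\|\mathbf{G}(x,\xi)-Gx\|^2]\le\sigma^2$ for all $x$, where $\sigma\ge 0$. Let $\gamma\in(0,1]$, $s\ge 1+3\gamma$, let $\tau\ge1$ be an integer, $\Lambda:=1+s-\gamma$, $0<\eta\le\frac{3\beta}{3+(7\Lambda+3)\tau}$, $t_k:=k+3s+\tau$ and $\eta_k:=\frac{\eta t_k}{2(t_k-s)}$. Given a deterministic $y^0$, put $z^0:=y^0$ and, for $k\ge0$, $$x^{k+1}:=y^k-\eta_k\widetilde G^k,\qquad z^{k+1}:=z^k+\tfrac{\gamma}{s}(x^{k+1}-y^k),\qquad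 y^{k+1}:=\tfrac{t_k-s}{t_k}x^{k+1}+\tfrac{s}{t_k}z^{k+1},\tag{AFP}$$ where $\widetilde G^k$ is a random estimator of $Gy^{k-\tau_k}$ with (possibly random) integer delays $0\le\tau_k\le\tau$ (and $y^j:=y^0$ for $j<0$) such that $$\mathbb{E}\big[\|\widetilde G^k-Gy^{k-\tau_k}\|^2\big]\le\frac{\hat\delta_k}{t_k(t_k-s)},\qquad \hat\delta_k\ge0 .$$ Suppose $\sum_k\hat\delta_k<+\infty$, and set $\delta_k:=2\hat\delta_k$ and $\mathcal S_\infty:=\sum_{k\ge0}\delta_k$. Then the following hold. (i) For every $x^\star\in\mathrm{zer}\,G$ and $k\ge0$, with $\mathcal R_0^2:=\frac{\eta(3s+\tau-1)^2}{2}\|Gy^0\|^2+\frac{2s^3}{\eta\gamma}\|y^0-x^\star\|^2$, $$\mathbb{E}[\|Gy^k\|^2]\le\frac{4(\mathcal R_0^2+\Lambda\eta\tau^{-1}\mathcal S_\infty)}{\eta(k+3s+\tau-1)^2},\qquad\text{and}\qquad \lim_{k\to\infty}(k+\tau)^2\,\mathbb{E}[\|Gy^k\|^2]=0 .$$ (ii)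 Almost surely, $\sum_{k\ge0}(k+\tau)\|Gy^k\|^2<+\infty$ and $\lim_{k\to\infty}(k+\tau)^2\|Gy^k\|^2=0$. Moreover, $\{x^k\}$, $\{y^k\}$ and $\{z^k\}$ converge almost surely to one and the same $\mathrm{zer}\,G$-valued random variable. (iii) (Iteration complexity.) Let $\eta:=\frac{3\beta}{3+(7\Lambda+3)\tau}$ and $\hat\delta_k:=\frac{\sigma^2}{(k+r)^{1+\omega}}$ with $r,\omega>0$. For every $R$ there is a constant $C$, depending only on $s,\gamma,r,\omega,R$, such that, whenever $\|Gy^0\|\le R$ and $\|y^0-x^\star\|\le R$ for some $x^\star\in\mathrm{zer}\,G$, for every $\epsilon>0$ at most $$C\Big(\frac{\sigma}{\epsilon\sqrt\tau}+\frac{\tau}{\epsilon}+\frac{\tau}{\beta\epsilon}\Big)$$ iterations are needed to reach $\mathbb{E}[\|Gy^k\|^2]\le\epsilon^2$, and this bound holds for all later $k$ as well. -/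

import Mathlib

open MeasureTheory Filter
open scoped Topology RealInnerProductSpace

universe u v w

noncomputable section

/-- `G` is `β`-co-coercive: `⟪G x - G y, x - y⟫ ≥ β ‖G x - G y‖²` for all `x, y`. -/
def IsCoCoercive {E : Type*} [NormedAddCommGroup E] [InnerProductSpace ℝ E]
    (β : ℝ) (G : E → E) : Prop :=
  ∀ x y : E, β * ‖G x - G y‖ ^ 2 ≤ ⟪G x - G y, x - y⟫

/-- `O` is an unbiased stochastic oracle for `G`, with samples of law `ν` and variance at most
`σ²`. -/
structure IsUnbiasedOracle {E Ξ : Type*} [NormedAddCommGroup E] [InnerProductSpace ℝ E]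
    [MeasurableSpace Ξ] (G : E → E) (O : E → Ξ → E) (ν : Measure Ξ) (σ : ℝ) : Prop where
  sigma_nonneg : 0 ≤ σ
  integrable : ∀ x, Integrable (O x) ν
  unbiased : ∀ x, ∫ ξ, O x ξ ∂ν = G x
  integrable_sq : ∀ x, Integrable (fun ξ => ‖O x ξ - G x‖ ^ 2) ν
  variance_le : ∀ x, ∫ ξ, ‖O x ξ - G x‖ ^ 2 ∂ν ≤ σ ^ 2

/-- The parameter `t_k = k + 3 s + τ`. -/
def afpT (s : ℝ) (τ k : ℕ) : ℝ := k + 3 * s + τ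

/-- The step size `η_k = η t_k / (2 (t_k - s))`. -/
def afpStep (s η : ℝ) (τ k : ℕ) : ℝ := η * afpT s τ k / (2 * (afpT s τ k - s))

/-- The constant `Λ = 1 + s - γ`. -/
def afpLambda (s γ : ℝ) : ℝ := 1 + s - γ

/-- The largest admissible value `3 β / (3 + (7 Λ + 3) τ)` of the parameter `η`. -/
def afpEtaMax (β s γ : ℝ) (τ : ℕ) : ℝ := 3 * β / (3 + (7 * afpLambda s γ + 3) * τ)

/-- The constant `R₀² = (η (3 s + τ - 1)² / 2) ‖G y⁰‖² + (2 s³ / (η γ)) ‖y⁰ - x⋆‖²`. -/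
def afpRSq {E : Type*} [NormedAddCommGroup E] (G : E → E) (s γ η : ℝ) (τ : ℕ) (y0 xs : E) : ℝ :=
  η * (3 * s + τ - 1) ^ 2 / 2 * ‖G y0‖ ^ 2 + 2 * s ^ 3 / (η * γ) * ‖y0 - xs‖ ^ 2

/-- The accelerated fixed-point scheme, run pathwise from the deterministic point `y0` with the
(random) estimators `Gt k`. The scheme defines `x k` for `k ≥ 1` only; `x 0` plays no role. -/
structure IsAFP {E Ω : Type*} [NormedAddCommGroup E] [InnerProductSpace ℝ E]
    (s γ η : ℝ) (τ : ℕ) (y0 : E) (Gt x y z : ℕ → Ω → E) : Prop where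
  y_zero : ∀ ω, y 0 ω = y0
  z_zero : ∀ ω, z 0 ω = y0
  x_succ : ∀ k ω, x (k + 1) ω = y k ω - afpStep s η τ k • Gt k ω
  z_succ : ∀ k ω, z (k + 1) ω = z k ω + (γ / s) • (x (k + 1) ω - y k ω)
  y_succ : ∀ k ω, y (k + 1) ω =
    ((afpT s τ k - s) / afpT s τ k) • x (k + 1) ω + (s / afpT s τ k) • z (k + 1) ω

/-- `Gt k` is a delayed stochastic estimator: it estimates `G` at the stale iterate
`y (k - d k)`, where the (possibly random) delays `d k` are at most `τ`, with mean squared error at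
most `δ k / (t_k (t_k - s))`. Subtraction of natural numbers is truncated, so `y (k - d k)` is
`y 0` when `d k > k`, in accordance with the convention `y⁰ = y⁻¹ = y⁻² = ⋯`. -/
structure IsDelayedEstimator {E Ω : Type*} [NormedAddCommGroup E] [MeasurableSpace E]
    [MeasurableSpace Ω] (P : Measure Ω) (G : E → E) (s : ℝ) (τ : ℕ) (δ : ℕ → ℝ)
    (d : ℕ → Ω → ℕ) (y Gt : ℕ → Ω → E) : Prop where
  measurable_delay : ∀ k, Measurable (d k)
  delay_le : ∀ k ω, d k ω ≤ τ
  measurable : ∀ k, Measurable (Gt k)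
  delta_nonneg : ∀ k, 0 ≤ δ k
  integrable_sq : ∀ k, Integrable (fun ω => ‖Gt k ω - G (y (k - d k ω) ω)‖ ^ 2) P
  error_le : ∀ k, ∫ ω, ‖Gt k ω - G (y (k - d k ω) ω)‖ ^ 2 ∂P ≤
    δ k / (afpT s τ k * (afpT s τ k - s))

end

/-! The estimate is pathwise: a fixed run is a deterministic scheme driven by vectors u with
arbitrary errors, and probability enters only at the end, through the weighted sum of squared
errors. No conditional unbiasedness of the estimator is used, so the term ⟪u - g, z - x⋆⟫ produced
by each step does not average out and must be absorbed.

The Lyapunov function `energy` is the usual accelerated combination of t²‖g‖², t⟪g, y - z⟫ and ‖z -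
x⋆‖², multiplied by weights slightly above their limits. Without the shift (a = 0) the distance
coefficient would be (s-1)(t-s)/t, which increases with t. With a > s - 1 it decreases, being s - 1
+ s(a - (s-1))/t to first order, and its decrement pays for ⟪u - g, z - x⋆⟫ by Young's inequality
(`innerCoeff_sq_le`). As a - (s-1) ≥ τ/3, the price is a multiple of t(t-s)/τ · ‖u - g‖², which
explains both the weight in the error assumption and the factor 1/τ in the rate. The result is
`energy_step`.

The delay is removed by bounding G(y at k - d) - G(y at k) by the last τ increments of G(y),
exchanging the order of summation, and absorbing the outcome in the negative increment terms given
by co-coercivity; this is what the bound on η is for (`energy_add_sum_le`). Lower bounds for the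
energy then give the rate.

If the weighted errors of a run are summable, then the gains t‖g‖² are summable, while the energy,
‖z - x⋆‖² and ‖y - z‖² converge, the last to 0. Hence t²‖g‖² has a limit, which must be 0 because
the harmonic series diverges. Convergence of the iterates follows by Opial's argument. Tonelli's
theorem gives summability of the errors almost surely together with an integrable majorant, so
integration yields the rate in expectation and dominated convergence its little-o form. -/

/-! ### Weights of the Lyapunov function and their monotonicity. -/

/-- The shift `a = (4 (s - 1) + τ) / 3` in the weights of the Lyapunov function. -/
noncomputable def weightShift (s τ : ℝ) : ℝ := (4 * (s - 1) + τ) / 3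

/-- The weight `(t - 1) / (t - 1 - a)`, which decreases to `1`. -/
noncomputable def weight (s τ t : ℝ) : ℝ := (t - 1) / (t - 1 - weightShift s τ)

/-- The factor `s - 1 + a / (t - 2 - a)`. -/
noncomputable def slopeFactor (s τ t : ℝ) : ℝ := s - 1 + weightShift s τ / (t - 2 - weightShift s τ)

/-- The coefficient `ω(t-1) (t-1) - ω(t) (t-s)` of the inner product released by one step. -/
noncomputable def innerCoeff (s τ t : ℝ) : ℝ := weight s τ t * slopeFactor s τ t

/-- The normalized coefficient of the squared distance in the Lyapunov function. -/
noncomputable def distCoeff (s τ t : ℝ) : ℝ := innerCoeff s τ t * (t - s) / t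

section Scalar

variable {s τ t γ : ℝ}

lemma shift_lt (hs : 1 < s) (hτ : 1 ≤ τ) (ht : 3 * s + τ - 1 ≤ t) :
    0 < t - 2 - weightShift s τ := by
  unfold weightShift; linarith

lemma weightShift_pos (hs : 1 < s) (hτ : 1 ≤ τ) : 0 < weightShift s τ := by
  unfold weightShift; linarith

lemma one_le_weight (hs : 1 < s) (hτ : 1 ≤ τ) (ht : 3 * s + τ - 1 ≤ t) : 1 ≤ weight s τ t := by
  have h := shift_lt hs hτ ht
  have h2 := weightShift_pos hs hτ
  unfold weight
  rw [le_div_iff₀ (by linarith)]; linarith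

lemma weight_le (hs : 1 < s) (hτ : 1 ≤ τ) (ht : 3 * s + τ - 1 ≤ t) : weight s τ t ≤ 9 / 5 := by
  have h := shift_lt hs hτ ht
  unfold weight
  rw [div_le_iff₀ (by linarith)]
  unfold weightShift; linarith

lemma slopeFactor_ge (hs : 1 < s) (hτ : 1 ≤ τ) (ht : 3 * s + τ - 1 ≤ t) :
    s - 1 + weightShift s τ / (t - 1 - weightShift s τ) ≤ slopeFactor s τ t := by
  have h := shift_lt hs hτ ht
  have h2 := weightShift_pos hs hτ
  unfold slopeFactor
  gcongr
  linarith

lemma slopeFactor_le (hs : 1 < s) (hτ : 1 ≤ τ) (ht : 3 * s + τ ≤ t) : slopeFactor s τ t ≤ s := by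
  have h := shift_lt hs hτ (by linarith : 3 * s + τ - 1 ≤ t)
  unfold slopeFactor
  have : weightShift s τ / (t - 2 - weightShift s τ) ≤ 1 := by
    rw [div_le_one h]; unfold weightShift; linarith
  linarith

lemma slopeFactor_gt (hs : 1 < s) (hτ : 1 ≤ τ) (ht : 3 * s + τ - 1 ≤ t) :
    s - 1 < slopeFactor s τ t := by
  have := div_pos (weightShift_pos hs hτ) (shift_lt hs hτ ht)
  unfold slopeFactor; linarith

lemma innerCoeff_pos (hs : 1 < s) (hτ : 1 ≤ τ) (ht : 3 * s + τ - 1 ≤ t) : 0 < innerCoeff s τ t := by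
  have := slopeFactor_gt hs hτ ht
  have := one_le_weight hs hτ ht
  unfold innerCoeff
  apply mul_pos <;> linarith

lemma innerCoeff_eq (hs : 1 < s) (hτ : 1 ≤ τ) (ht : 3 * s + τ - 1 ≤ t) :
    weight s τ (t - 1) * (t - 1) - weight s τ t * (t - s) = innerCoeff s τ t := by
  have h := shift_lt hs hτ ht
  have h1 : t - 2 - weightShift s τ ≠ 0 := h.ne'
  have h2 : t - 1 - weightShift s τ ≠ 0 := by linarith
  unfold innerCoeff weight slopeFactor
  rw [show t - 1 - 1 - weightShift s τ = t - 2 - weightShift s τ by ring]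
  field_simp
  ring

lemma weight_sq_diff (hs : 1 < s) (hτ : 1 ≤ τ) (ht : 3 * s + τ - 1 ≤ t) :
    weight s τ (t - 1) * (t - 1) ^ 2 - weight s τ t * (t * (t - 2 * s + 2 * γ)) =
      weight s τ t * (2 * t * (s - 1 - γ) +
        (t - 1) * (weightShift s τ / (t - 2 - weightShift s τ)) + 1) := by
  have h := innerCoeff_eq hs hτ ht
  unfold innerCoeff slopeFactor at h
  linear_combination (t - 1) * h

/-- To first order in 1/t the coefficient is s - 1 + s(a - (s-1))/t, so the decrement is governed by
a - (s-1). The exact lower bound is shaped to be compared with the square of `innerCoeff`. -/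
lemma distCoeff_sub_ge (hs : 1 < s) (hτ : 1 ≤ τ) (ht : 3 * s + τ ≤ t) :
    (weightShift s τ - (s - 1)) * ((t - 2) * slopeFactor s τ t + (t - s)) /
        ((t - 1) * (t - 1 - weightShift s τ) * (t - 2 - weightShift s τ)) ≤
      distCoeff s τ (t - 1) - distCoeff s τ t := by
  have h := shift_lt hs hτ (by linarith : 3 * s + τ - 1 ≤ t - 1 + 1)
  have h' := shift_lt hs hτ (by linarith : 3 * s + τ - 1 ≤ t - 1)
  have ha : 0 ≤ weightShift s τ - (s - 1) := by unfold weightShift; linarith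
  unfold distCoeff innerCoeff weight slopeFactor
  generalize hb : weightShift s τ = b at *
  -- Slack variables x, c, p replace the inequalities between s, b and t; the cleared numerator is
  -- then a polynomial with nonnegative coefficients, which `positivity` recognizes. The later
  -- scalar lemmas use the same device.
  obtain ⟨x, rfl⟩ : ∃ x, s = 1 + x := ⟨s - 1, by ring⟩
  obtain ⟨c, rfl⟩ : ∃ c, b = x + c := ⟨b - x, by ring⟩
  obtain ⟨p, rfl⟩ : ∃ p, t = p + 3 + x + c := ⟨t - 3 - x - c, by ring⟩
  have hp : 0 < p := by linarith
  have hx : 0 < x := by linarith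
  have hc : 0 ≤ c := by linarith
  rw [show p + 3 + x + c - 1 - 1 - (x + c) = p + 1 by ring,
    show p + 3 + x + c - 1 - 2 - (x + c) = p by ring,
    show p + 3 + x + c - 1 - (x + c) = p + 2 by ring,
    show p + 3 + x + c - 2 - (x + c) = p + 1 by ring,
    show p + 3 + x + c - 1 - 1 = p + 1 + x + c by ring,
    show p + 3 + x + c - 1 - (1 + x) = p + 1 + c by ring,
    show p + 3 + x + c - 1 = p + 2 + x + c by ring,
    show p + 3 + x + c - 2 = p + 1 + x + c by ring,
    show p + 3 + x + c - (1 + x) = p + 2 + c by ring,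
    show (1 : ℝ) + x - 1 = x by ring, show x + c - x = c by ring]
  rw [← sub_nonneg]
  have key : (p + 1 + x + c) / (p + 1) * (x + (x + c) / p) * (p + 1 + c) / (p + 2 + x + c) -
      (p + 2 + x + c) / (p + 2) * (x + (x + c) / (p + 1)) * (p + 2 + c) / (p + 3 + x + c) -
      c * ((p + 1 + x + c) * (x + (x + c) / (p + 1)) + (p + 2 + c)) /
        ((p + 2 + x + c) * (p + 2) * (p + 1)) =
      ((p + 1 + x + c) * (x * p + x + c) * (p + 1 + c) * (p + 1) * (p + 2) * (p + 3 + x + c) -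
        (p + 2 + x + c) * (x * (p + 1) + x + c) * (p + 2 + c) * p * (p + 1) * (p + 2 + x + c) -
        c * ((p + 1 + x + c) * (x * (p + 1) + x + c) + (p + 2 + c) * (p + 1)) * p *
          (p + 3 + x + c)) /
        (p * (p + 1) ^ 2 * (p + 2) * (p + 2 + x + c) * (p + 3 + x + c)) := by
    field_simp
    ring
  rw [key]
  apply div_nonneg _ (by positivity)
  ring_nf
  positivity

/-- This is what the weights are designed for: Young's inequality applied to ⟪u - g, z - x⋆⟫ against
the decrement of the distance coefficient costs at most a multiple of t(t-s)/τ. -/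
lemma innerCoeff_sq_le (hs : 1 < s) (hτ : 1 ≤ τ) (ht : 3 * s + τ ≤ t) :
    τ * innerCoeff s τ t ^ 2 ≤
      3 * (s - 1 + 1 / 6) * (t * (t - s)) * (distCoeff s τ (t - 1) - distCoeff s τ t) := by
  have hD := distCoeff_sub_ge hs hτ ht
  have hw := shift_lt hs hτ (by linarith : 3 * s + τ - 1 ≤ t)
  have hA := slopeFactor_gt hs hτ (by linarith : 3 * s + τ - 1 ≤ t)
  have hK : slopeFactor s τ t ^ 2 * (t - 1) * (t - 2 - weightShift s τ) ≤
      (s - 1 + 1 / 6) * (t - 1 - weightShift s τ) *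
        ((t - 2) * slopeFactor s τ t + (t - s)) := by
    unfold slopeFactor
    generalize hb : weightShift s τ = b at *
    have hb' : b = (4 * (s - 1) + τ) / 3 := by rw [← hb]; rfl
    have e : s - 1 + b / (t - 2 - b) = ((s - 1) * (t - 2 - b) + b) / (t - 2 - b) := by
      field_simp
    rw [e, div_pow, ← sub_nonneg]
    have key : (s - 1 + 1 / 6) * (t - 1 - b) *
        ((t - 2) * (((s - 1) * (t - 2 - b) + b) / (t - 2 - b)) + (t - s)) -
        ((s - 1) * (t - 2 - b) + b) ^ 2 / (t - 2 - b) ^ 2 * (t - 1) * (t - 2 - b) =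
        ((s - 1 + 1 / 6) * (t - 1 - b) * ((t - 2) * ((s - 1) * (t - 2 - b) + b) +
          (t - s) * (t - 2 - b)) - ((s - 1) * (t - 2 - b) + b) ^ 2 * (t - 1)) / (t - 2 - b) := by
      field_simp
    rw [key]
    apply div_nonneg _ hw.le
    subst hb'
    obtain ⟨x, rfl⟩ : ∃ x, s = 1 + x := ⟨s - 1, by ring⟩
    obtain ⟨y, rfl⟩ : ∃ y, τ = 1 + y := ⟨τ - 1, by ring⟩
    obtain ⟨k, rfl⟩ : ∃ k, t = k + 3 * (1 + x) + (1 + y) := ⟨t - 3 * (1 + x) - (1 + y), by ring⟩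
    have hk : 0 ≤ k := by linarith
    have hx : 0 < x := by linarith
    have hy : 0 ≤ y := by linarith
    ring_nf
    positivity
  have ht0 : 0 < t - 1 := by linarith
  have hts : 0 < t - s := by linarith
  have htt : 0 < t := by linarith
  have hm : 0 < t - 1 - weightShift s τ := by linarith
  have ha : weightShift s τ - (s - 1) = (τ + (s - 1)) / 3 := by unfold weightShift; ring
  have hw' : t - 2 - weightShift s τ ≠ 0 := hw.ne'
  have hσ : 0 < s - 1 + 1 / 6 := by linarith
  -- The factor τ is gained here, from the part τ/3 of a - (s-1).
  have hn : τ * (t - 1) ^ 2 ≤ 3 * (t * (t - s)) * (weightShift s τ - (s - 1)) := by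
    rw [ha]; nlinarith [mul_pos ht0 (by linarith : 0 < s - 1),
      mul_nonneg (by linarith : 0 ≤ s - 1) (by linarith : 0 ≤ t - s - τ)]
  calc τ * innerCoeff s τ t ^ 2
      = τ * (t - 1) ^ 2 * (slopeFactor s τ t ^ 2 / (t - 1 - weightShift s τ) ^ 2) := by
        unfold innerCoeff weight; field_simp
    _ ≤ 3 * (t * (t - s)) * (weightShift s τ - (s - 1)) *
          (slopeFactor s τ t ^ 2 / (t - 1 - weightShift s τ) ^ 2) := by gcongr
    _ = 3 * (t * (t - s)) * (weightShift s τ - (s - 1)) /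
          ((t - 1 - weightShift s τ) ^ 2 * (t - 1) * (t - 2 - weightShift s τ)) *
          (slopeFactor s τ t ^ 2 * (t - 1) * (t - 2 - weightShift s τ)) := by
        field_simp
    _ ≤ 3 * (t * (t - s)) * (weightShift s τ - (s - 1)) /
          ((t - 1 - weightShift s τ) ^ 2 * (t - 1) * (t - 2 - weightShift s τ)) *
          ((s - 1 + 1 / 6) * (t - 1 - weightShift s τ) *
            ((t - 2) * slopeFactor s τ t + (t - s))) := by
        apply mul_le_mul_of_nonneg_left hK
        rw [ha]
        have : 0 ≤ (τ + (s - 1)) / 3 := by linarith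
        positivity
    _ = 3 * (s - 1 + 1 / 6) * (t * (t - s)) *
          ((weightShift s τ - (s - 1)) * ((t - 2) * slopeFactor s τ t + (t - s)) /
            ((t - 1) * (t - 1 - weightShift s τ) * (t - 2 - weightShift s τ))) := by
        field_simp
    _ ≤ _ := by gcongr

end Scalar

/-! ### Numerical bounds on the weights and on the remainders of Young's inequality. -/

section Scalar

variable {s τ t γ : ℝ}

lemma le_distCoeff (hs : 1 < s) (hτ : 1 ≤ τ) (ht : 3 * s + τ - 1 ≤ t) :
    s - 1 ≤ distCoeff s τ t := by
  have hw := shift_lt hs hτ ht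
  have ha := weightShift_pos hs hτ
  have has : s - 1 ≤ weightShift s τ := by unfold weightShift; linarith
  unfold distCoeff innerCoeff weight slopeFactor
  generalize weightShift s τ = b at *
  have h1 : t - 1 - b ≠ 0 := by linarith
  have h2 : t - 2 - b ≠ 0 := by linarith
  rw [le_div_iff₀ (by linarith), show (t - 1) / (t - 1 - b) * (s - 1 + b / (t - 2 - b)) * (t - s) =
    ((t - 1) * ((s - 1) * (t - 2 - b) + b) * (t - s)) / ((t - 1 - b) * (t - 2 - b)) by field_simp,
    le_div_iff₀ (by apply mul_pos <;> linarith)]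
  obtain ⟨x, rfl⟩ : ∃ x, s = 1 + x := ⟨s - 1, by ring⟩
  obtain ⟨c, rfl⟩ : ∃ c, b = x + c := ⟨b - x, by ring⟩
  obtain ⟨p, rfl⟩ : ∃ p, t = p + 2 + x + c := ⟨t - 2 - x - c, by ring⟩
  have hp : 0 < p := by linarith
  have hx : 0 < x := by linarith
  have hc : 0 ≤ c := by linarith
  rw [← sub_nonneg]
  ring_nf
  positivity

lemma distCoeff_init_le (hs : 1 < s) (hτ : 1 ≤ τ) :
    distCoeff s τ (3 * s + τ - 1) ≤ 3 / 2 * (s - 1) + 3 / 4 := by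
  have hw := shift_lt hs hτ le_rfl
  unfold distCoeff innerCoeff weight slopeFactor
  generalize hb : weightShift s τ = b at *
  have hb' : b = (4 * (s - 1) + τ) / 3 := by rw [← hb]; rfl
  generalize ht : 3 * s + τ - 1 = t at *
  have h1 : t - 1 - b ≠ 0 := by linarith
  have h2 : t - 2 - b ≠ 0 := by linarith
  rw [div_le_iff₀ (by linarith), show (t - 1) / (t - 1 - b) * (s - 1 + b / (t - 2 - b)) * (t - s) =
    ((t - 1) * ((s - 1) * (t - 2 - b) + b) * (t - s)) / ((t - 1 - b) * (t - 2 - b)) by field_simp,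
    div_le_iff₀ (by apply mul_pos <;> linarith)]
  subst ht hb'
  obtain ⟨x, rfl⟩ : ∃ x, s = 1 + x := ⟨s - 1, by ring⟩
  obtain ⟨y, rfl⟩ : ∃ y, τ = 1 + y := ⟨τ - 1, by ring⟩
  have hx : 0 < x := by linarith
  have hy : 0 ≤ y := by linarith
  rw [← sub_nonneg]
  ring_nf
  positivity

lemma sum_window (s t : ℝ) (N : ℕ) :
    ∑ i ∈ Finset.range N, (t + (i + 1)) * (t + (i + 1) - s) =
      N * (t * (t - s)) + N * (N + 1) / 2 * (t + (t - s)) + N * (N + 1) * (2 * N + 1) / 6 := by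
  induction N with
  | zero => simp
  | succ n ih => rw [Finset.sum_range_succ, ih]; push_cast; ring

/-- The constant 14/9 is sharp: for t close to N and N large the sum is about (1 + 1 + 1/3) N³ = 7/3
N³, while the weight is about 3/2. Without the weight the factor would be 7/3. -/
lemma sum_window_le (hs : 1 < s) {N : ℕ} (hτ : 1 ≤ N) (ht : 3 * s + N ≤ t) :
    ∑ i ∈ Finset.range N, (t + (i + 1)) * (t + (i + 1) - s) ≤
      14 / 9 * (weight s N t * (N * (t * (t - s)))) := by
  rw [sum_window]
  have hτ' : (1 : ℝ) ≤ N := by exact_mod_cast hτ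
  generalize (N : ℝ) = τ at *
  have hw := shift_lt hs hτ' (by linarith : 3 * s + τ - 1 ≤ t)
  unfold weight
  unfold weightShift at *
  rw [show 14 / 9 * ((t - 1) / (t - 1 - (4 * (s - 1) + τ) / 3) * (τ * (t * (t - s)))) =
    14 / 9 * (t - 1) * (τ * (t * (t - s))) / (t - 1 - (4 * (s - 1) + τ) / 3) by ring,
    le_div_iff₀ (by linarith)]
  obtain ⟨x, rfl⟩ : ∃ x, s = 1 + x := ⟨s - 1, by ring⟩
  obtain ⟨y, rfl⟩ : ∃ y, τ = 1 + y := ⟨τ - 1, by ring⟩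
  obtain ⟨k, rfl⟩ : ∃ k, t = k + 3 * (1 + x) + (1 + y) := ⟨t - 3 * (1 + x) - (1 + y), by ring⟩
  have hk : 0 ≤ k := by linarith
  have hx : 0 < x := by linarith
  have hy : 0 ≤ y := by linarith
  rw [← sub_nonneg]
  ring_nf
  positivity

/-- The ratio `t / (t - s)` is at most `3 / 2`. -/
lemma ratio_le (hs : 1 < s) (hτ : 1 ≤ τ) (ht : 3 * s + τ ≤ t) : t / (t - s) ≤ 3 / 2 := by
  rw [div_le_iff₀ (by linarith)]; linarith

lemma weight_mul_ratio_le (hs : 1 < s) (hτ : 1 ≤ τ) (ht : 3 * s + τ ≤ t) :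
    s * (weight s τ t * (t / (t - s))) ≤ 1 + 28 * s * slopeFactor s τ t := by
  have hw := shift_lt hs hτ (by linarith : 3 * s + τ - 1 ≤ t)
  have hA := slopeFactor_ge hs hτ (by linarith : 3 * s + τ - 1 ≤ t)
  refine le_trans ?_ (add_le_add_right (mul_le_mul_of_nonneg_left hA (by linarith : 0 ≤ 28 * s)) 1)
  unfold weight
  generalize hb : weightShift s τ = b at *
  have hb' : b = (4 * (s - 1) + τ) / 3 := by rw [← hb]; rfl
  have h1 : t - 1 - b ≠ 0 := by linarith
  have h2 : t - s ≠ 0 := by linarith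
  rw [show s * ((t - 1) / (t - 1 - b) * (t / (t - s))) =
      (s * (t - 1) * t) / ((t - 1 - b) * (t - s)) by field_simp,
    div_le_iff₀ (by apply mul_pos <;> linarith),
    show (1 + 28 * s * (s - 1 + b / (t - 1 - b))) * ((t - 1 - b) * (t - s)) =
      ((t - 1 - b) + 28 * s * ((s - 1) * (t - 1 - b) + b)) * (t - s) by field_simp]
  subst hb'
  obtain ⟨x, rfl⟩ : ∃ x, s = 1 + x := ⟨s - 1, by ring⟩
  obtain ⟨y, rfl⟩ : ∃ y, τ = 1 + y := ⟨τ - 1, by ring⟩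
  obtain ⟨k, rfl⟩ : ∃ k, t = k + 3 * (1 + x) + (1 + y) := ⟨t - 3 * (1 + x) - (1 + y), by ring⟩
  have hk : 0 ≤ k := by linarith
  have hx : 0 < x := by linarith
  have hy : 0 ≤ y := by linarith
  rw [← sub_nonneg]
  ring_nf
  positivity

/-- A bound for the constant of the cross term. -/
noncomputable def crossConst (s : ℝ) : ℝ := if s ≤ 2 then 3 / 4 else 81 / (1120 * (s - 1))

/-- For s near 1 the summand 1 on the right is needed. For s > 2 it is dropped: the slope factor
exceeds s - 1 and the weight times t/(t-s) is at most 9/5 · 3/2, which gives 3/4 · 27/10 / 28 =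
81/1120. -/
lemma three_fourths_mul_le_crossConst (hs : 1 < s) (hτ : 1 ≤ τ) (ht : 3 * s + τ ≤ t) :
    3 / 4 * (s * (weight s τ t * (t / (t - s)))) ≤
      crossConst s * (1 + 28 * s * slopeFactor s τ t) := by
  unfold crossConst
  have h := weight_mul_ratio_le hs hτ ht
  split_ifs with h2
  · linarith
  · have hr := ratio_le hs hτ ht
    have hw := weight_le hs hτ (by linarith : 3 * s + τ - 1 ≤ t)
    have hA := slopeFactor_gt hs hτ (by linarith : 3 * s + τ - 1 ≤ t)
    have hr0 : 0 ≤ t / (t - s) := div_nonneg (by linarith) (by linarith)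
    have : weight s τ t * (t / (t - s)) ≤ 9 / 5 * (3 / 2) := by gcongr
    rw [div_mul_eq_mul_div (81 : ℝ), le_div_iff₀ (by linarith)]
    have h3 : s * (weight s τ t * (t / (t - s))) ≤ s * (9 / 5 * (3 / 2)) := by gcongr
    have h4 : s * (s - 1) ≤ s * slopeFactor s τ t := by gcongr
    nlinarith [mul_le_mul_of_nonneg_right h3 (by linarith : 0 ≤ s - 1)]

/-- The coefficient of `‖g‖²` which is left for the cross term. -/
noncomputable def crossGain (s γ τ t : ℝ) : ℝ :=
  weightShift s τ * (s - γ) / 4 + 7 / 3 * s * slopeFactor s τ t * afpLambda s γ * τ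

lemma crossGain_pos (hγ : 0 < γ) (hsγ : 1 + 3 * γ ≤ s) (hτ : 1 ≤ τ) (ht : 3 * s + τ ≤ t) :
    0 < crossGain s γ τ t := by
  have hs : 1 < s := by linarith
  have h1 := weightShift_pos hs hτ
  have h2 := slopeFactor_gt hs hτ (by linarith : 3 * s + τ - 1 ≤ t)
  have h3 : 0 < s - γ := by linarith
  have h4 : 0 < afpLambda s γ := by unfold afpLambda; linarith
  have h5 : 0 < slopeFactor s τ t := by linarith
  unfold crossGain
  positivity

lemma cross_term_le (hγ : 0 < γ) (hsγ : 1 + 3 * γ ≤ s) (hτ : 1 ≤ τ) (ht : 3 * s + τ ≤ t) :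
    weight s τ t * t ^ 2 * (s - γ) ^ 2 / (16 * crossGain s γ τ t) ≤
      crossConst s * (t * (t - s) / τ) := by
  have hs : 1 < s := by linarith
  have hG := crossGain_pos hγ hsγ hτ ht
  have hA := slopeFactor_gt hs hτ (by linarith : 3 * s + τ - 1 ≤ t)
  have hw := one_le_weight hs hτ (by linarith : 3 * s + τ - 1 ≤ t)
  have hc := three_fourths_mul_le_crossConst hs hτ ht
  have hts : 0 < t - s := by linarith
  have ht0 : 0 < t := by linarith
  -- This uses a ≥ τ/3, Λ ≥ s - γ and 7/3 = 28/12.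
  have hG' : τ * (s - γ) * (1 + 28 * s * slopeFactor s τ t) / 12 ≤ crossGain s γ τ t := by
    unfold crossGain afpLambda weightShift
    have : 0 ≤ s * slopeFactor s τ t * τ := by
      have : 0 < slopeFactor s τ t := by linarith
      positivity
    nlinarith [mul_nonneg (by linarith : 0 ≤ s - 1) (by linarith : 0 ≤ s - γ)]
  have hc0 : 0 ≤ crossConst s := by
    unfold crossConst; split_ifs
    · norm_num
    · apply div_nonneg <;> linarith
  have hsg : 0 < s - γ := by linarith
  rw [div_le_iff₀ (by linarith)]
  calc weight s τ t * t ^ 2 * (s - γ) ^ 2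
      ≤ weight s τ t * t ^ 2 * (s * (s - γ)) := by
        gcongr; rw [sq]; gcongr; linarith
    _ = (3 / 4 * (s * (weight s τ t * (t / (t - s))))) * (4 / 3 * (s - γ) * (t * (t - s))) := by
        field_simp
    _ ≤ (crossConst s * (1 + 28 * s * slopeFactor s τ t)) * (4 / 3 * (s - γ) * (t * (t - s))) := by
        gcongr
    _ = crossConst s * (t * (t - s) / τ) *
          (16 * (τ * (s - γ) * (1 + 28 * s * slopeFactor s τ t) / 12)) := by
        field_simp; ring
    _ ≤ _ := by gcongr

/-- The constant in front of the squared errors in the one-step estimate. -/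
noncomputable def errConst (s γ : ℝ) : ℝ :=
  3 / 4 * γ * (s - 1 + 1 / 6) + 81 / 640 + 9 / 128 * γ + crossConst s

/-- The four summands are the coefficients of ‖u - g‖² left by the four uses of Young's inequality
in `energy_step`: against ‖g' - g‖², against ‖g‖², against the distance decrement, and in the bound
of ‖u‖². -/
lemma err_terms_le (hγ : 0 < γ) (hsγ : 1 + 3 * γ ≤ s) (hτ : 1 ≤ τ) (ht : 3 * s + τ ≤ t) :
    weight s τ t * t ^ 3 / (32 * τ * (t - s)) +
        weight s τ t * t ^ 2 * (s - γ) ^ 2 / (16 * crossGain s γ τ t) +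
        γ * innerCoeff s τ t ^ 2 / (4 * (distCoeff s τ (t - 1) - distCoeff s τ t)) +
        5 / 16 * γ * innerCoeff s τ t * (t / (t - s)) ≤
      errConst s γ * (t * (t - s) / τ) := by
  have hs : 1 < s := by linarith
  have hw1 := one_le_weight hs hτ (by linarith : 3 * s + τ - 1 ≤ t)
  have hw2 := weight_le hs hτ (by linarith : 3 * s + τ - 1 ≤ t)
  have hr := ratio_le hs hτ ht
  have hts : 0 < t - s := by linarith
  have ht0 : 0 < t := by linarith
  have hτ0 : 0 < τ := by linarith
  have hA1 := slopeFactor_gt hs hτ (by linarith : 3 * s + τ - 1 ≤ t)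
  have hA2 := slopeFactor_le hs hτ ht
  have hD0 : 0 < distCoeff s τ (t - 1) - distCoeff s τ t := by
    by_contra! hcon
    have h1 := innerCoeff_sq_le hs hτ ht
    have h2 : 0 < τ * innerCoeff s τ t ^ 2 := by
      have := innerCoeff_pos hs hτ (by linarith : 3 * s + τ - 1 ≤ t)
      positivity
    have h3 : 0 ≤ 3 * (s - 1 + 1 / 6) * (t * (t - s)) := by
      have : 0 ≤ s - 1 + 1 / 6 := by linarith
      positivity
    nlinarith
  have e1 : weight s τ t * t ^ 3 / (32 * τ * (t - s)) ≤ 81 / 640 * (t * (t - s) / τ) := by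
    calc weight s τ t * t ^ 3 / (32 * τ * (t - s))
        = weight s τ t * (t / (t - s)) ^ 2 / 32 * (t * (t - s) / τ) := by field_simp
      _ ≤ 9 / 5 * (3 / 2) ^ 2 / 32 * (t * (t - s) / τ) := by gcongr
      _ = _ := by ring
  have e2 := cross_term_le hγ hsγ hτ ht
  have e3 : γ * innerCoeff s τ t ^ 2 / (4 * (distCoeff s τ (t - 1) - distCoeff s τ t)) ≤
      3 / 4 * γ * (s - 1 + 1 / 6) * (t * (t - s) / τ) := by
    rw [div_le_iff₀ (by linarith)]
    have := mul_le_mul_of_nonneg_left (innerCoeff_sq_le hs hτ ht) (by positivity : 0 ≤ γ / τ)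
    calc γ * innerCoeff s τ t ^ 2 = γ / τ * (τ * innerCoeff s τ t ^ 2) := by field_simp
      _ ≤ _ := this
      _ = _ := by ring
  have e4 : 5 / 16 * γ * innerCoeff s τ t * (t / (t - s)) ≤
      9 / 128 * γ * (t * (t - s) / τ) := by
    have h1 : innerCoeff s τ t ≤ 9 / 5 * s := by
      unfold innerCoeff; gcongr; linarith
    calc 5 / 16 * γ * innerCoeff s τ t * (t / (t - s))
        ≤ 5 / 16 * γ * (9 / 5 * s) * (t / (t - s)) := by gcongr
      _ = 9 / 128 * γ * (t * (8 * s / (t - s))) := by field_simp; ring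
      _ ≤ 9 / 128 * γ * (t * ((t - s) / τ)) := by
        gcongr 9 / 128 * γ * (t * ?_)
        rw [div_le_div_iff₀ hts hτ0]
        -- As t - s ≥ 2s + τ, the arithmetic-geometric inequality gives (t-s)² ≥ 8sτ.
        nlinarith [sq_nonneg (2 * s - τ)]
      _ = _ := by ring
  unfold errConst
  linarith

lemma errConst_pos (hγ : 0 < γ) (hsγ : 1 + 3 * γ ≤ s) : 0 < errConst s γ := by
  unfold errConst crossConst
  have : 0 < s - 1 + 1 / 6 := by linarith
  split_ifs
  · positivity
  · have : 0 < s - 1 := by linarith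
    positivity

/-- The factor 1 - γ/(s-1) is the one lost in `rate_le_energy`; having it here lets it cancel and
leaves the constant Λ in the rate. -/
lemma errConst_le (hγ : 0 < γ) (hγ1 : γ ≤ 1) (hsγ : 1 + 3 * γ ≤ s) :
    errConst s γ ≤ (1 - γ / (s - 1)) * afpLambda s γ := by
  have hs : 0 < s - 1 := by linarith
  unfold errConst crossConst afpLambda
  rw [show (1 - γ / (s - 1)) * (1 + s - γ) = (s - 1 - γ) * (1 + s - γ) / (s - 1) by field_simp,
    le_div_iff₀ hs]
  obtain ⟨x, rfl⟩ : ∃ x, s = 1 + x := ⟨s - 1, by ring⟩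
  have hx : 0 < x := by linarith
  have hγx : γ ≤ x / 3 := by linarith
  split_ifs with h
  · have h1 : 3 / 4 * γ * (1 + x - 1 + 1 / 6) + 81 / 640 + 9 / 128 * γ + 3 / 4 ≤ 4 / 3 := by
      nlinarith
    have h2 := mul_le_mul_of_nonneg_right h1 hs.le
    have h3 : 2 * x / 3 * 2 ≤ (1 + x - 1 - γ) * (1 + (1 + x) - γ) := by
      apply mul_le_mul <;> linarith
    linarith
  · have : 81 / (1120 * (1 + x - 1)) * (1 + x - 1) = 81 / 1120 := by field_simp
    rw [add_mul, this]
    -- The right side minus the left decreases in γ, so the worst case is γ = min(x/3, 1). In each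
    -- branch `h1` is the difference between the value at γ and the value at this endpoint.
    rcases le_total x 3 with hx3 | hx3
    · have h1 : 0 ≤ (x / 3 - γ) * (2 * x + 2 - x / 3 - γ +
          x * (3 / 4 * (x + 1 / 6) + 9 / 128)) := by
        apply mul_nonneg (by linarith)
        have : 0 ≤ x * (3 / 4 * (x + 1 / 6) + 9 / 128) := by positivity
        linarith
      have h2 : 0 ≤ (x - 1) * (3 - x) * (x + 2) :=
        mul_nonneg (mul_nonneg (by linarith) (by linarith)) (by linarith)
      nlinarith
    · have h1 : 0 ≤ (1 - γ) * (2 * x + 2 - 1 - γ +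
          x * (3 / 4 * (x + 1 / 6) + 9 / 128)) := by
        apply mul_nonneg (by linarith)
        have : 0 ≤ x * (3 / 4 * (x + 1 / 6) + 9 / 128) := by positivity
        linarith
      nlinarith [mul_nonneg (by linarith : 0 ≤ x - 3) hx.le]

/-- Here 28/9 = 2 · 14/9: the 2 comes from splitting off the delay and 14/9 from `sum_window_le`.
The right side is the multiple of τ available for increments in `energy_step`. -/
lemma errConst_le' (hγ : 0 < γ) (hγ1 : γ ≤ 1) (hsγ : 1 + 3 * γ ≤ s) :
    28 / 9 * errConst s γ ≤ 7 / 3 * afpLambda s γ - 1 := by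
  have hs : 0 < s - 1 := by linarith
  unfold errConst crossConst afpLambda
  split_ifs with h
  · nlinarith
  · have : 81 / (1120 * (s - 1)) ≤ 81 / 1120 := by
      apply div_le_div_of_nonneg_left <;> linarith
    nlinarith

end Scalar

/-! ### One step of the scheme: descent of the Lyapunov function. -/

section Step

variable {E : Type*} [NormedAddCommGroup E] [InnerProductSpace ℝ E]

/-- The Lyapunov function of the accelerated scheme, at the value `g` of the operator, the
difference `w = y - z` and the error `v = z - x⋆`. -/
noncomputable def energy (s γ η τ t : ℝ) (g w v : E) : ℝ :=
  η / 4 * weight s τ t * t ^ 2 * ‖g‖ ^ 2 + s * weight s τ t * t * ⟪g, w⟫ +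
    s ^ 2 * distCoeff s τ t / (γ * η) * ‖v‖ ^ 2

variable {s τ t γ η β : ℝ} {y z u g g' x' z' y' xs : E}

/-- The displacement y' - y has two expressions, one through y' - z' and one through y - z. Pairing
the first with g' and the second with g makes the mixed term of the Lyapunov function telescope. -/
lemma inner_step (hs : 0 < s) (hts : 0 < t - s) (hx : x' = y - (η * t / (2 * (t - s))) • u)
    (hz : z' = z + (γ / s) • (x' - y)) (hy : y' = ((t - s) / t) • x' + (s / t) • z') :
    t * (t - s) * ⟪g' - g, y' - y⟫ = s * (t - s) * ⟪g, y - z⟫ - s * t * ⟪g', y' - z'⟫ -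
      η * t ^ 2 / 2 * ⟪g', u⟫ + η * t / 2 * (t - s + γ) * ⟪g, u⟫ := by
  have ht : t ≠ 0 := by linarith
  have hs0 : s ≠ 0 := hs.ne'
  have hts0 : t - s ≠ 0 := hts.ne'
  have e1 : t • y' = (t - s) • x' + s • z' := by
    rw [hy, smul_add, smul_smul, smul_smul, mul_div_cancel₀ _ ht, mul_div_cancel₀ _ ht]
  have e0 : (t - s) • x' = (t - s) • y - (η * t / 2) • u := by
    rw [hx, smul_sub, smul_smul]; congr 2; field_simp
  have e2 : s • z' = s • z + γ • (x' - y) := by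
    rw [hz, smul_add, smul_smul, mul_div_cancel₀ _ hs0]
  have v1 : (t - s) • (y' - y) = -(s • (y' - z')) - (η * t / 2) • u := by
    have : (t - s) • (y' - y) = t • y' - s • y' - (t - s) • y := by module
    rw [this, e1, e0]; module
  have e3 : (t - s) • x' - (t - s) • y = -((η * t / 2) • u) := by rw [e0]; module
  have v2 : ((t - s) * t) • (y' - y) =
      -((s * (t - s)) • (y - z)) - (η * t / 2 * (t - s + γ)) • u := by
    have : ((t - s) * t) • (y' - y) = (t - s) • (t • y') - ((t - s) * t) • y := by module
    rw [this, e1, e2]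
    have : (t - s) • ((t - s) • x' + (s • z + γ • (x' - y))) - ((t - s) * t) • y =
        (t - s + γ) • ((t - s) • x' - (t - s) • y) - (s * (t - s)) • (y - z) := by module
    rw [this, e3]; module
  have i1 := congrArg (fun v => ⟪g', v⟫) v1
  have i2 := congrArg (fun v => ⟪g, v⟫) v2
  simp only [inner_sub_right, inner_neg_right, inner_smul_right] at i1 i2
  simp only [inner_sub_left, inner_sub_right]
  linear_combination t * i1 - i2

/-- Co-coercivity is used between y' and y with weight ω t(t-s), and between y and x⋆ with weight
sρ, where ω is the weight and ρ is `innerCoeff`. Releasing sρ⟪g, y - z⟫ leaves -sρ⟪g, z - x⋆⟫. The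
normalization of `distCoeff` makes the linear term in the expansion of ‖z' - x⋆‖² equal to -sρ⟪u, z
- x⋆⟫, so only the pairing with the error u - g survives. -/
lemma energy_step_exact (hs : 1 < s) (hτ : 1 ≤ τ) (ht : 3 * s + τ ≤ t) (hη : 0 < η) (hγ : 0 < γ)
    (hx : x' = y - (η * t / (2 * (t - s))) • u)
    (hz : z' = z + (γ / s) • (x' - y)) (hy : y' = ((t - s) / t) • x' + (s / t) • z')
    (hco : β * ‖g' - g‖ ^ 2 ≤ ⟪g' - g, y' - y⟫) (hco' : β * ‖g‖ ^ 2 ≤ ⟪g, y - xs⟫) :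
    energy s γ η τ t g' (y' - z') (z' - xs) ≤ energy s γ η τ (t - 1) g (y - z) (z - xs) -
      η / 4 * (weight s τ (t - 1) * (t - 1) ^ 2 - weight s τ t * (t * (t - 2 * s + 2 * γ))) *
        ‖g‖ ^ 2 - weight s τ t * (β * (t * (t - s)) - η * t ^ 2 / 4) * ‖g' - g‖ ^ 2 -
      weight s τ t * (η * t / 2) * (t * ⟪g' - g, u - g⟫ + (s - γ) * ⟪g, u - g⟫) -
      s * innerCoeff s τ t * (β * ‖g‖ ^ 2) - s * innerCoeff s τ t * ⟪u - g, z - xs⟫ +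
      innerCoeff s τ t * γ * (η * t / (4 * (t - s))) * ‖u‖ ^ 2 -
      s ^ 2 / (γ * η) * (distCoeff s τ (t - 1) - distCoeff s τ t) * ‖z - xs‖ ^ 2 := by
  have hs0 : 0 < s := by linarith
  have hts : 0 < t - s := by linarith
  have ht0 : 0 < t := by linarith
  have hρ := innerCoeff_pos hs hτ (by linarith : 3 * s + τ - 1 ≤ t)
  have hρe := innerCoeff_eq hs hτ (by linarith : 3 * s + τ - 1 ≤ t)
  have hω : 0 < weight s τ t := by linarith [one_le_weight hs hτ (by linarith : 3 * s + τ - 1 ≤ t)]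
  have hstep := inner_step (g := g) (g' := g') hs0 hts hx hz hy
  have hv : z' - xs = (z - xs) - (γ * (η * t / (2 * (t - s))) / s) • u := by
    rw [hz, hx]; module
  have hc : s ^ 2 * distCoeff s τ t / (γ * η) * ‖z' - xs‖ ^ 2 =
      s ^ 2 * distCoeff s τ t / (γ * η) * ‖z - xs‖ ^ 2 - s * innerCoeff s τ t * ⟪u, z - xs⟫ +
      innerCoeff s τ t * γ * (η * t / (4 * (t - s))) * ‖u‖ ^ 2 := by
    rw [hv, norm_sub_sq_real, inner_smul_right, norm_smul, mul_pow, Real.norm_eq_abs, sq_abs,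
      real_inner_comm]
    unfold distCoeff
    field_simp
    ring
  have hyz : ⟪g, y - z⟫ = ⟪g, y - xs⟫ - ⟪g, z - xs⟫ := by
    rw [← inner_sub_right]; congr 1; abel
  have hΔ : ‖g' - g‖ ^ 2 = ‖g'‖ ^ 2 - 2 * ⟪g', g⟫ + ‖g‖ ^ 2 := norm_sub_sq_real _ _
  have i1 : ⟪g' - g, u - g⟫ = ⟪g', u⟫ - ⟪g', g⟫ - ⟪g, u⟫ + ‖g‖ ^ 2 := by
    rw [inner_sub_left, inner_sub_right, inner_sub_right, real_inner_self_eq_norm_sq]; ring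
  have i2 : ⟪g, u - g⟫ = ⟪g, u⟫ - ‖g‖ ^ 2 := by
    rw [inner_sub_right, real_inner_self_eq_norm_sq]
  have i3 : ⟪u - g, z - xs⟫ = ⟪u, z - xs⟫ - ⟪g, z - xs⟫ := inner_sub_left _ _ _
  have m1 := mul_le_mul_of_nonneg_left hco (by positivity : 0 ≤ weight s τ t * (t * (t - s)))
  have m2 := mul_le_mul_of_nonneg_left hco' (by positivity : 0 ≤ s * innerCoeff s τ t)
  unfold energy
  rw [hc, i1, i2, i3]
  rw [hyz] at hstep ⊢
  linear_combination m1 + m2 + weight s τ t * hstep -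
    (s * (⟪g, y - xs⟫ - ⟪g, z - xs⟫)) * hρe - weight s τ t * η * t ^ 2 / 4 * hΔ

lemma neg_young_le_mul_inner {P : ℝ} (hP : 0 < P) (c : ℝ) (a b : E) :
    -(P * ‖a‖ ^ 2 + c ^ 2 / (4 * P) * ‖b‖ ^ 2) ≤ c * ⟪a, b⟫ := by
  have h : 0 ≤ ‖(2 * P) • a + c • b‖ ^ 2 / (4 * P) := by positivity
  rw [norm_add_sq_real, norm_smul, norm_smul, mul_pow, mul_pow, Real.norm_eq_abs,
    Real.norm_eq_abs, sq_abs, sq_abs, inner_smul_left, inner_smul_right] at h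
  have e : ((2 * P) ^ 2 * ‖a‖ ^ 2 + 2 * ((starRingEnd ℝ) (2 * P) * (c * ⟪a, b⟫)) +
      c ^ 2 * ‖b‖ ^ 2) / (4 * P) = P * ‖a‖ ^ 2 + c ^ 2 / (4 * P) * ‖b‖ ^ 2 + c * ⟪a, b⟫ := by
    simp only [conj_trivial]
    field_simp
    ring
  rw [e] at h
  linarith

lemma distCoeff_sub_pos (hs : 1 < s) (hτ : 1 ≤ τ) (ht : 3 * s + τ ≤ t) :
    0 < distCoeff s τ (t - 1) - distCoeff s τ t := by
  by_contra! hcon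
  have h1 := innerCoeff_sq_le hs hτ ht
  have h2 : 0 < τ * innerCoeff s τ t ^ 2 := by
    have := innerCoeff_pos hs hτ (by linarith : 3 * s + τ - 1 ≤ t)
    positivity
  have h3 : 0 ≤ 3 * (s - 1 + 1 / 6) * (t * (t - s)) := by
    have : 0 ≤ s - 1 + 1 / 6 := by linarith
    have : 0 ≤ t - s := by linarith
    have : 0 ≤ t := by linarith
    positivity
  nlinarith

/-- The term 2t(s-1-γ) is kept as the summable gain. The excess of the weight over 1 and the term
with a/(t-2-a) together give the rest, which supplies the first half of `crossGain`. -/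
lemma weight_gain_ge (hγ : 0 < γ) (hsγ : 1 + 3 * γ ≤ s) (hτ : 1 ≤ τ) (ht : 3 * s + τ ≤ t) :
    2 * t * (s - 1 - γ) + weight s τ t * (weightShift s τ * (s - γ)) ≤
      weight s τ t * (2 * t * (s - 1 - γ) +
        (t - 1) * (weightShift s τ / (t - 2 - weightShift s τ)) + 1) := by
  have hs : 1 < s := by linarith
  have hw := shift_lt hs hτ (by linarith : 3 * s + τ - 1 ≤ t)
  have ha := weightShift_pos hs hτ
  have h1 := one_le_weight hs hτ (by linarith : 3 * s + τ - 1 ≤ t)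
  have h2 : weightShift s τ ≤ (t - 1) * (weightShift s τ / (t - 2 - weightShift s τ)) := by
    rw [← mul_div_assoc, le_div_iff₀ hw]
    nlinarith
  have h3 : weight s τ t * weightShift s τ ≤ t * (weight s τ t - 1) := by
    have : weight s τ t - 1 = weightShift s τ / (t - 1 - weightShift s τ) := by
      unfold weight
      have : t - 1 - weightShift s τ ≠ 0 := by linarith
      field_simp
      ring
    rw [this]
    unfold weight
    rw [div_mul_eq_mul_div, ← mul_div_assoc]
    gcongr <;> linarith
  have h4 := mul_le_mul_of_nonneg_right h3 (by linarith : 0 ≤ s - 1 - γ)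
  have h5 := mul_le_mul_of_nonneg_left h2 (by linarith : 0 ≤ weight s τ t)
  have h6 : 0 ≤ weight s τ t * (weightShift s τ * (s - 1 - γ)) := by
    have : 0 ≤ s - 1 - γ := by linarith
    positivity
  linarith

set_option maxHeartbeats 800000 in
/-- The one-step estimate for the Lyapunov function. -/
lemma energy_step (hγ : 0 < γ) (hsγ : 1 + 3 * γ ≤ s) (hτ : 1 ≤ τ)
    (ht : 3 * s + τ ≤ t) (hη : 0 < η) (hβ : η * (1 + (7 / 3 * afpLambda s γ + 1) * τ) ≤ β)
    (hx : x' = y - (η * t / (2 * (t - s))) • u)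
    (hz : z' = z + (γ / s) • (x' - y)) (hy : y' = ((t - s) / t) • x' + (s / t) • z')
    (hco : β * ‖g' - g‖ ^ 2 ≤ ⟪g' - g, y' - y⟫) (hco' : β * ‖g‖ ^ 2 ≤ ⟪g, y - xs⟫) :
    energy s γ η τ t g' (y' - z') (z' - xs) ≤ energy s γ η τ (t - 1) g (y - z) (z - xs) -
      η / 2 * (s - 1 - γ) * (t * ‖g‖ ^ 2) -
      η * (weight s τ t * (t * (t - s))) * ((7 / 3 * afpLambda s γ - 1) * τ + 5 / 8) *
        ‖g' - g‖ ^ 2 +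
      η * (errConst s γ * (t * (t - s) / τ)) * ‖u - g‖ ^ 2 := by
  have hs : 1 < s := by linarith
  have hs0 : 0 < s := by linarith
  have hts : 0 < t - s := by linarith
  have ht0 : 0 < t := by linarith
  have hτ0 : 0 < τ := by linarith
  have hρ := innerCoeff_pos hs hτ (by linarith : 3 * s + τ - 1 ≤ t)
  have hω := one_le_weight hs hτ (by linarith : 3 * s + τ - 1 ≤ t)
  have hω0 : 0 < weight s τ t := by linarith
  have hD := distCoeff_sub_pos hs hτ ht
  have hΓ := crossGain_pos hγ hsγ hτ ht
  have hr := ratio_le hs hτ ht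
  have main := energy_step_exact hs hτ ht hη hγ hx hz hy hco hco'
  rw [weight_sq_diff hs hτ (by linarith)] at main
  -- The first three splittings spend 2τ of the increment budget, all of `crossGain`, and exactly
  -- the distance decrement.
  have y1 := neg_young_le_mul_inner (by positivity : 0 < η * weight s τ t * (2 * τ * t * (t - s)))
    (weight s τ t * η * t ^ 2 / 2) (g' - g) (u - g)
  have y2 := neg_young_le_mul_inner (by positivity : 0 < η * weight s τ t * crossGain s γ τ t)
    (weight s τ t * η * t * (s - γ) / 2) g (u - g)
  have y3 := neg_young_le_mul_inner (by positivity : 0 < s ^ 2 / (γ * η) *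
    (distCoeff s τ (t - 1) - distCoeff s τ t)) (s * innerCoeff s τ t) (z - xs) (u - g)
  -- The parameter 4 gives ‖u‖² ≤ 5/4 ‖u - g‖² + 5 ‖g‖².
  have y4 := neg_young_le_mul_inner (by norm_num : (0 : ℝ) < 4) (-2) g (u - g)
  rw [real_inner_comm] at y3
  have e1 : (weight s τ t * η * t ^ 2 / 2) ^ 2 /
      (4 * (η * weight s τ t * (2 * τ * t * (t - s)))) =
      η * (weight s τ t * t ^ 3 / (32 * τ * (t - s))) := by field_simp; ring
  have e2 : (weight s τ t * η * t * (s - γ) / 2) ^ 2 /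
      (4 * (η * weight s τ t * crossGain s γ τ t)) =
      η * (weight s τ t * t ^ 2 * (s - γ) ^ 2 / (16 * crossGain s γ τ t)) := by field_simp; ring
  have e3 : (s * innerCoeff s τ t) ^ 2 / (4 * (s ^ 2 / (γ * η) *
      (distCoeff s τ (t - 1) - distCoeff s τ t))) =
      η * (γ * innerCoeff s τ t ^ 2 / (4 * (distCoeff s τ (t - 1) - distCoeff s τ t))) := by
    field_simp
  rw [e1] at y1
  rw [e2] at y2
  rw [e3] at y3
  have hu : ‖u‖ ^ 2 ≤ 5 / 4 * ‖u - g‖ ^ 2 + 5 * ‖g‖ ^ 2 := by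
    have : ‖u‖ ^ 2 = ‖g‖ ^ 2 + 2 * ⟪g, u - g⟫ + ‖u - g‖ ^ 2 := by
      rw [← norm_add_sq_real, add_sub_cancel]
    norm_num at y4
    linarith
  have hu' := mul_le_mul_of_nonneg_left hu
    (by positivity : 0 ≤ innerCoeff s τ t * γ * (η * t / (4 * (t - s))))
  have e4 : innerCoeff s τ t * γ * (η * t / (4 * (t - s))) * (5 / 4 * ‖u - g‖ ^ 2 + 5 * ‖g‖ ^ 2) =
      η * (5 / 16 * γ * innerCoeff s τ t * (t / (t - s))) * ‖u - g‖ ^ 2 +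
      η * (5 / 4 * γ * innerCoeff s τ t * (t / (t - s))) * ‖g‖ ^ 2 := by field_simp; ring
  have hE := mul_le_mul_of_nonneg_right (mul_le_mul_of_nonneg_left
    (err_terms_le hγ hsγ hτ ht) hη.le) (sq_nonneg ‖u - g‖)
  have hg1 : η * (5 / 4 * γ * innerCoeff s τ t * (t / (t - s))) ≤
      η * (2 * s * innerCoeff s τ t) := by
    have : γ * (t / (t - s)) ≤ s * (3 / 2) := by
      gcongr; linarith
    calc η * (5 / 4 * γ * innerCoeff s τ t * (t / (t - s)))
        = η * innerCoeff s τ t * (5 / 4) * (γ * (t / (t - s))) := by ring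
      _ ≤ η * innerCoeff s τ t * (5 / 4) * (s * (3 / 2)) := by gcongr
      _ = η * (15 / 8 * s * innerCoeff s τ t) := by ring
      _ ≤ _ := by gcongr; norm_num
  have hΛ : 0 < afpLambda s γ := by unfold afpLambda; linarith
  have hβ2 : η * (2 + 7 / 3 * afpLambda s γ * τ) ≤ β := by nlinarith
  have hg2 : η * (2 * s * innerCoeff s τ t) + η * (weight s τ t *
      (7 / 3 * s * slopeFactor s τ t * afpLambda s γ * τ)) ≤ s * innerCoeff s τ t * β := by
    have := mul_le_mul_of_nonneg_left hβ2 (by positivity : 0 ≤ s * innerCoeff s τ t)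
    refine le_trans (le_of_eq ?_) this
    unfold innerCoeff; ring
  have hg3 := mul_le_mul_of_nonneg_left (weight_gain_ge hγ hsγ hτ ht) hη.le
  have hg : η / 2 * (s - 1 - γ) * t + η * weight s τ t * crossGain s γ τ t +
      η * (5 / 4 * γ * innerCoeff s τ t * (t / (t - s))) ≤
      η / 4 * (weight s τ t * (2 * t * (s - 1 - γ) +
        (t - 1) * (weightShift s τ / (t - 2 - weightShift s τ)) + 1)) +
      s * innerCoeff s τ t * β := by
    have : η * weight s τ t * crossGain s γ τ t =
        η * (weight s τ t * (weightShift s τ * (s - γ))) / 4 + η * (weight s τ t *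
          (7 / 3 * s * slopeFactor s τ t * afpLambda s γ * τ)) := by unfold crossGain; ring
    rw [this]
    linarith
  have hg' := mul_le_mul_of_nonneg_right hg (sq_nonneg ‖g‖)
  -- Budget for ‖g' - g‖²: of β ≥ η(1 + (7/3 Λ + 1)τ), Young takes 2τ and t²/4 ≤ 3/8 t(t-s) takes
  -- 3/8, leaving (7/3 Λ - 1)τ + 5/8.
  have hd : η * (weight s τ t * (t * (t - s))) * ((7 / 3 * afpLambda s γ - 1) * τ + 5 / 8) +
      η * weight s τ t * (2 * τ * t * (t - s)) ≤
      weight s τ t * (β * (t * (t - s)) - η * t ^ 2 / 4) := by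
    have h1 := mul_le_mul_of_nonneg_right hβ (by positivity : 0 ≤ t * (t - s))
    have h2 : t ^ 2 ≤ 3 / 2 * (t * (t - s)) := by nlinarith
    have h3 := mul_le_mul_of_nonneg_left h2 hη.le
    have : η * (t * (t - s)) * ((7 / 3 * afpLambda s γ - 1) * τ + 5 / 8) +
        η * (2 * τ * t * (t - s)) ≤ β * (t * (t - s)) - η * t ^ 2 / 4 := by linarith
    linarith [mul_le_mul_of_nonneg_left this hω0.le]
  have hd' := mul_le_mul_of_nonneg_right hd (sq_nonneg ‖g' - g‖)
  rw [e4] at hu'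
  linear_combination main + y1 + y2 + y3 + hu' + hE + hg' + hd'

end Step

/-! ### Lower bounds of the energy and its initial value. -/

section Bounds

variable {E : Type*} [NormedAddCommGroup E] [InnerProductSpace ℝ E]
variable {s τ t γ η β : ℝ} {y z g xs : E}

/-- Writing ⟪g, y - z⟫ as a nonnegative term minus ⟪g, z - x⋆⟫, one completes the square using the
full distance term. In the limiting case of weight 1 and distance coefficient s - 1, the fraction 1
- γ/(s-1) of the gradient term is exactly what remains. -/
lemma rate_le_energy (hγ : 0 < γ) (hsγ : 1 + 3 * γ ≤ s) (hτ : 1 ≤ τ) (ht : 3 * s + τ - 1 ≤ t)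
    (hη : 0 < η) (hmono : 0 ≤ ⟪g, y - xs⟫) :
    (1 - γ / (s - 1)) * (η / 4 * t ^ 2 * ‖g‖ ^ 2) ≤ energy s γ η τ t g (y - z) (z - xs) := by
  have hs : 1 < s := by linarith
  have ht0 : 0 < t := by linarith
  have h1 := one_le_weight hs hτ ht
  have h2 := weight_le hs hτ ht
  have hq := le_distCoeff hs hτ ht
  have hs1 : 0 < s - 1 := by linarith
  have hyz : ⟪g, y - z⟫ = ⟪g, y - xs⟫ - ⟪g, z - xs⟫ := by
    rw [← inner_sub_right]; congr 1; abel
  have hX : 0 < weight s τ t - (1 - γ / (s - 1)) := by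
    have := div_pos hγ hs1
    linarith
  have hy := neg_young_le_mul_inner (by positivity :
    0 < η / 4 * t ^ 2 * (weight s τ t - (1 - γ / (s - 1)))) (-(s * weight s τ t * t)) g (z - xs)
  have e : (-(s * weight s τ t * t)) ^ 2 /
      (4 * (η / 4 * t ^ 2 * (weight s τ t - (1 - γ / (s - 1))))) =
      s ^ 2 * weight s τ t ^ 2 / (η * (weight s τ t - (1 - γ / (s - 1)))) := by
    field_simp
  have h3 : s ^ 2 * weight s τ t ^ 2 / (η * (weight s τ t - (1 - γ / (s - 1)))) ≤
      s ^ 2 * distCoeff s τ t / (γ * η) := by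
    rw [div_le_div_iff₀ (by positivity) (by positivity)]
    have h4 : γ * weight s τ t ^ 2 ≤
        (s - 1) * (weight s τ t - (1 - γ / (s - 1))) := by
      have : (s - 1) * (weight s τ t - (1 - γ / (s - 1))) =
          (s - 1) * (weight s τ t - 1) + γ := by field_simp; ring
      rw [this]
      nlinarith [mul_nonneg (by linarith : 0 ≤ weight s τ t - 1)
        (by linarith : 0 ≤ s - 1 - 3 * γ), mul_nonneg hγ.le (mul_nonneg
        (by linarith : 0 ≤ weight s τ t - 1) (by linarith : 0 ≤ 2 - weight s τ t))]
    have h5 := h4.trans (mul_le_mul_of_nonneg_right hq hX.le)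
    calc s ^ 2 * weight s τ t ^ 2 * (γ * η) = s ^ 2 * η * (γ * weight s τ t ^ 2) := by ring
      _ ≤ s ^ 2 * η * (distCoeff s τ t * (weight s τ t - (1 - γ / (s - 1)))) := by gcongr
      _ = _ := by ring
  rw [e] at hy
  have h6 := mul_le_mul_of_nonneg_right h3 (sq_nonneg ‖z - xs‖)
  have h7 : 0 ≤ s * weight s τ t * t * ⟪g, y - xs⟫ := by
    apply mul_nonneg _ hmono
    have : 0 < s := by linarith
    have : 0 < weight s τ t := by linarith
    positivity
  unfold energy
  rw [hyz]
  linarith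

/-- Now the whole gradient term is spent on the square. The distance term has room because (s-1)/γ ≥
3 exceeds the weight plus 1. -/
lemma dist_le_energy (hγ : 0 < γ) (hsγ : 1 + 3 * γ ≤ s) (hτ : 1 ≤ τ) (ht : 3 * s + τ - 1 ≤ t)
    (hη : 0 < η) (hmono : 0 ≤ ⟪g, y - xs⟫) :
    s ^ 2 / η * ‖z - xs‖ ^ 2 ≤ energy s γ η τ t g (y - z) (z - xs) := by
  have hs : 1 < s := by linarith
  have ht0 : 0 < t := by linarith
  have h1 := one_le_weight hs hτ ht
  have h2 := weight_le hs hτ ht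
  have hq := le_distCoeff hs hτ ht
  have hω : 0 < weight s τ t := by linarith
  have hyz : ⟪g, y - z⟫ = ⟪g, y - xs⟫ - ⟪g, z - xs⟫ := by
    rw [← inner_sub_right]; congr 1; abel
  have hy := neg_young_le_mul_inner (by positivity :
    0 < η / 4 * t ^ 2 * weight s τ t) (-(s * weight s τ t * t)) g (z - xs)
  have e : (-(s * weight s τ t * t)) ^ 2 / (4 * (η / 4 * t ^ 2 * weight s τ t)) =
      s ^ 2 / η * weight s τ t := by
    field_simp
  have h3 : s ^ 2 / η * weight s τ t + s ^ 2 / η ≤ s ^ 2 * distCoeff s τ t / (γ * η) := by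
    have : weight s τ t + 1 ≤ distCoeff s τ t / γ := by
      rw [le_div_iff₀ hγ]; nlinarith
    calc s ^ 2 / η * weight s τ t + s ^ 2 / η = s ^ 2 / η * (weight s τ t + 1) := by ring
      _ ≤ s ^ 2 / η * (distCoeff s τ t / γ) := by gcongr
      _ = _ := by field_simp
  rw [e] at hy
  have h6 := mul_le_mul_of_nonneg_right h3 (sq_nonneg ‖z - xs‖)
  have h7 : 0 ≤ s * weight s τ t * t * ⟪g, y - xs⟫ := by
    apply mul_nonneg _ hmono
    have : 0 < s := by linarith
    positivity
  unfold energy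
  rw [hyz]
  linarith

/-- The mixed term vanishes. The initial weight can be too large for the prescribed coefficient of
‖G y0‖², by at most 7/60; the Lipschitz bound turns this excess into a multiple of ‖y0 - xs‖²/η,
which the surplus in the distance coefficient covers. -/
lemma energy_init_le {G : E → E} {τ : ℕ} {y0 : E} (hγ : 0 < γ) (hγ1 : γ ≤ 1)
    (hsγ : 1 + 3 * γ ≤ s) (hτ : (1 : ℝ) ≤ τ)
    (hη : 0 < η) (hβ : η * (1 + (7 / 3 * afpLambda s γ + 1) * τ) ≤ β)
    (hlip : β * ‖G y0‖ ≤ ‖y0 - xs‖) :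
    energy s γ η τ (3 * s + τ - 1) (G y0) (y0 - y0) (y0 - xs) ≤
      (1 - γ / (s - 1)) * afpRSq G s γ η τ y0 xs := by
  have hs : 1 < s := by linarith
  have hs1 : 0 < s - 1 := by linarith
  have h2 := weight_le hs hτ le_rfl
  have hq := distCoeff_init_le hs hτ
  have hX : 2 / 3 ≤ 1 - γ / (s - 1) := by
    have : γ / (s - 1) ≤ 1 / 3 := by rw [div_le_iff₀ hs1]; linarith
    linarith
  have hXs : 1 / 12 ≤ 2 * (1 - γ / (s - 1)) * s - distCoeff s τ (3 * s + τ - 1) := by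
    suffices 1 / 12 + (3 / 2 * (s - 1) + 3 / 4) ≤ 2 * (1 - γ / (s - 1)) * s by linarith
    rcases le_total s 4 with h4 | h4
    · nlinarith
    · rw [show 2 * (1 - γ / (s - 1)) * s = 2 * (s - 1 - γ) * s / (s - 1) by field_simp,
        le_div_iff₀ hs1]
      nlinarith
  have hsg : 12 * γ ≤ s ^ 2 := by nlinarith [sq_nonneg (1 - 3 * γ)]
  have htb : η * (3 * s + τ - 1) * ‖G y0‖ ≤ 9 / 7 * ‖y0 - xs‖ := by
    have h1 : η * (3 * s + τ - 1) ≤ 9 / 7 * β := by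
      have : 3 * s + τ - 1 ≤ 9 / 7 * (1 + (7 / 3 * afpLambda s γ + 1) * τ) := by
        unfold afpLambda; nlinarith [mul_nonneg (by linarith : 0 ≤ s) (by linarith : 0 ≤ (τ : ℝ) - 1),
          mul_nonneg (by linarith : 0 ≤ 1 - γ) (by linarith : (0 : ℝ) ≤ τ)]
      calc η * (3 * s + τ - 1) ≤ η * (9 / 7 * (1 + (7 / 3 * afpLambda s γ + 1) * τ)) := by gcongr
        _ = 9 / 7 * (η * (1 + (7 / 3 * afpLambda s γ + 1) * τ)) := by ring
        _ ≤ _ := by gcongr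
    have := mul_le_mul_of_nonneg_right h1 (norm_nonneg (G y0))
    linarith
  have htb2 : (η * (3 * s + τ - 1) * ‖G y0‖) ^ 2 ≤ (9 / 7 * ‖y0 - xs‖) ^ 2 := by
    apply pow_le_pow_left₀ _ htb
    have : 0 ≤ 3 * s + τ - 1 := by linarith
    positivity
  have hA : η * ((3 * s + τ - 1) ^ 2 * ‖G y0‖ ^ 2) ≤ 81 / 49 * (‖y0 - xs‖ ^ 2 / η) := by
    rw [← mul_div_assoc, le_div_iff₀ hη]; linarith
  have hB : ‖y0 - xs‖ ^ 2 / η ≤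
      s ^ 2 / (γ * η) * (2 * (1 - γ / (s - 1)) * s - distCoeff s τ (3 * s + τ - 1)) *
        ‖y0 - xs‖ ^ 2 := by
    have h12 : 1 / η ≤ s ^ 2 / (γ * η) * (1 / 12) := by
      rw [div_mul_div_comm, div_le_div_iff₀ hη (by positivity)]
      nlinarith
    calc ‖y0 - xs‖ ^ 2 / η = 1 / η * ‖y0 - xs‖ ^ 2 := by ring
      _ ≤ s ^ 2 / (γ * η) * (1 / 12) * ‖y0 - xs‖ ^ 2 := by gcongr
      _ ≤ _ := by gcongr
  have hp : 0 ≤ ‖y0 - xs‖ ^ 2 / η := by positivity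
  have hp2 : 0 ≤ η * ((3 * s + τ - 1) ^ 2 * ‖G y0‖ ^ 2) := by positivity
  have e1 : s ^ 2 / (γ * η) * (2 * (1 - γ / (s - 1)) * s - distCoeff s τ (3 * s + τ - 1)) *
      ‖y0 - xs‖ ^ 2 = (1 - γ / (s - 1)) * (2 * s ^ 3 / (η * γ) * ‖y0 - xs‖ ^ 2) -
      s ^ 2 * distCoeff s τ (3 * s + τ - 1) / (γ * η) * ‖y0 - xs‖ ^ 2 := by
    field_simp
  have hω := mul_le_mul_of_nonneg_right (by linarith : weight s τ (3 * s + τ - 1) / 4 ≤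
    (1 - γ / (s - 1)) / 2 + 7 / 60) hp2
  unfold energy afpRSq
  rw [sub_self, inner_zero_right]
  linarith

end Bounds

/-! ### Delays, and the summed inequality along a run. -/

lemma norm_sub_sq_le_sum {F : Type*} [SeminormedAddCommGroup F] {f : ℕ → F} {k d τ : ℕ} (hd : d ≤ τ) :
    ‖f (k - d) - f k‖ ^ 2 ≤ τ * ∑ j ∈ Finset.Ico (k - τ) k, ‖f (j + 1) - f j‖ ^ 2 := by
  have h1 : ‖f (k - d) - f k‖ ≤ ∑ j ∈ Finset.Ico (k - d) k, ‖f (j + 1) - f j‖ := by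
    rw [norm_sub_rev, ← Finset.sum_Ico_sub f (Nat.sub_le k d)]
    exact norm_sum_le _ _
  have h2 : (k - (k - d) : ℕ) ≤ (τ : ℝ) := by
    exact_mod_cast (by omega : k - (k - d) ≤ τ)
  calc ‖f (k - d) - f k‖ ^ 2 ≤ (∑ j ∈ Finset.Ico (k - d) k, ‖f (j + 1) - f j‖) ^ 2 := by gcongr
    _ ≤ (Finset.Ico (k - d) k).card * ∑ j ∈ Finset.Ico (k - d) k, ‖f (j + 1) - f j‖ ^ 2 :=
        sq_sum_le_card_mul_sum_sq
    _ ≤ τ * ∑ j ∈ Finset.Ico (k - τ) k, ‖f (j + 1) - f j‖ ^ 2 := by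
        rw [Nat.card_Ico]
        gcongr

section Path

variable {E : Type*} [NormedAddCommGroup E] [InnerProductSpace ℝ E]

/-- A single run of the accelerated scheme with admissible parameters, driven by the estimates
`u k` of `G (y (k - d k))`. -/
structure AdmissibleRun (s γ η β : ℝ) (τ : ℕ) (G : E → E) (d : ℕ → ℕ) (u x y z : ℕ → E) :
    Prop where
  gamma_pos : 0 < γ
  gamma_le : γ ≤ 1
  le_s : 1 + 3 * γ ≤ s
  one_le_tau : 1 ≤ τ
  eta_pos : 0 < η
  eta_le : η ≤ afpEtaMax β s γ τ
  beta_pos : 0 < β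
  coCoercive : IsCoCoercive β G
  delay_le : ∀ k, d k ≤ τ
  z_zero : z 0 = y 0
  x_succ : ∀ k, x (k + 1) = y k - afpStep s η τ k • u k
  z_succ : ∀ k, z (k + 1) = z k + (γ / s) • (x (k + 1) - y k)
  y_succ : ∀ k, y (k + 1) =
    ((afpT s τ k - s) / afpT s τ k) • x (k + 1) + (s / afpT s τ k) • z (k + 1)

/-- The Lyapunov function along a run. -/
noncomputable def pathEnergy (s γ η : ℝ) (τ : ℕ) (G : E → E) (y z : ℕ → E) (xs : E) (k : ℕ) : ℝ :=
  energy s γ η τ (afpT s τ k - 1) (G (y k)) (y k - z k) (z k - xs)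

/-- The weight `t_k (t_k - s)` of the squared error of the `k`-th estimator. -/
noncomputable def errWeight (s : ℝ) (τ k : ℕ) : ℝ := afpT s τ k * (afpT s τ k - s)

lemma IsCoCoercive.mul_norm_sq_le {β : ℝ} {G : E → E} (hG : IsCoCoercive β G) {xs : E}
    (hxs : G xs = 0) (y : E) : β * ‖G y‖ ^ 2 ≤ ⟪G y, y - xs⟫ := by
  simpa [hxs] using hG y xs

lemma IsCoCoercive.mul_norm_sub_le {β : ℝ} {G : E → E} (hG : IsCoCoercive β G)
    (x y : E) : β * ‖G x - G y‖ ≤ ‖x - y‖ := by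
  rcases eq_or_ne (G x - G y) 0 with h | h
  · simp [h]
  · have h1 := (hG x y).trans (real_inner_le_norm _ _)
    have h2 := norm_pos_iff.2 h
    nlinarith

/-- After exchanging the sums, the increment j is counted only for j < k ≤ j + τ. -/
lemma sum_mul_window_le {a f : ℕ → ℝ} (ha : ∀ k, 0 ≤ a k) (hf : ∀ k, 0 ≤ f k) (τ N : ℕ) :
    ∑ k ∈ Finset.range N, a k * ∑ j ∈ Finset.Ico (k - τ) k, f j ≤
      ∑ j ∈ Finset.range N, f j * ∑ i ∈ Finset.range τ, a (j + 1 + i) := by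
  have h1 : ∑ k ∈ Finset.range N, ∑ j ∈ Finset.Ico (k - τ) k, a k * f j =
      ∑ j ∈ Finset.range N, ∑ k ∈ (Finset.range N).filter (fun k => k - τ ≤ j ∧ j < k),
        a k * f j := by
    apply Finset.sum_comm'
    intro k j
    simp only [Finset.mem_range, Finset.mem_Ico, Finset.mem_filter]
    constructor <;> rintro ⟨h1, h2⟩ <;> omega
  simp only [Finset.mul_sum]
  rw [h1]
  apply Finset.sum_le_sum
  intro j _
  rw [← Finset.mul_sum, ← Finset.sum_mul, mul_comm]
  refine mul_le_mul_of_nonneg_left ?_ (hf j)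
  rw [show ∑ i ∈ Finset.range τ, a (j + 1 + i) = ∑ k ∈ Finset.Ico (j + 1) (j + 1 + τ), a k by
    rw [Finset.sum_Ico_eq_sum_range]; simp]
  apply Finset.sum_le_sum_of_subset_of_nonneg
  · intro k hk
    simp only [Finset.mem_filter, Finset.mem_Ico, Finset.mem_range] at *
    omega
  · intro k _ _
    exact ha k

namespace AdmissibleRun

variable {s γ η β : ℝ} {τ : ℕ} {G : E → E} {d : ℕ → ℕ} {u x y z : ℕ → E}

lemma one_lt_s (h : AdmissibleRun s γ η β τ G d u x y z) : 1 < s := by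
  linarith [h.gamma_pos, h.le_s]

lemma one_le_tau' (h : AdmissibleRun s γ η β τ G d u x y z) : (1 : ℝ) ≤ τ := by
  exact_mod_cast h.one_le_tau

lemma le_afpT (s : ℝ) (τ k : ℕ) : 3 * s + τ ≤ afpT s τ k := by
  unfold afpT
  have : (0 : ℝ) ≤ k := by positivity
  linarith

lemma afpT_succ (s : ℝ) (τ k : ℕ) : afpT s τ (k + 1) = afpT s τ k + 1 := by
  unfold afpT; push_cast; ring

lemma errWeight_pos (h : AdmissibleRun s γ η β τ G d u x y z) (k : ℕ) : 0 < errWeight s τ k := by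
  have h1 := le_afpT s τ k
  have h2 := h.one_lt_s
  have h3 := h.one_le_tau'
  unfold errWeight
  apply mul_pos <;> linarith

lemma lambda_pos (h : AdmissibleRun s γ η β τ G d u x y z) : 0 < afpLambda s γ := by
  unfold afpLambda; linarith [h.one_lt_s, h.gamma_le]

lemma eta_mul_le (h : AdmissibleRun s γ η β τ G d u x y z) :
    η * (1 + (7 / 3 * afpLambda s γ + 1) * τ) ≤ β := by
  have h1 := h.eta_le
  have := h.lambda_pos
  have := h.one_le_tau'
  unfold afpEtaMax at h1
  rw [le_div_iff₀ (by positivity)] at h1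
  linarith

/-- The one-step estimate along a run. -/
lemma energy_succ_le (h : AdmissibleRun s γ η β τ G d u x y z) {xs : E} (hxs : G xs = 0) (k : ℕ) :
    pathEnergy s γ η τ G y z xs (k + 1) ≤ pathEnergy s γ η τ G y z xs k -
      η / 2 * (s - 1 - γ) * (afpT s τ k * ‖G (y k)‖ ^ 2) -
      η * (weight s τ (afpT s τ k) * errWeight s τ k) *
        ((7 / 3 * afpLambda s γ - 1) * τ + 5 / 8) * ‖G (y (k + 1)) - G (y k)‖ ^ 2 +
      η * (errConst s γ * (errWeight s τ k / τ)) * ‖u k - G (y k)‖ ^ 2 := by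
  have := energy_step (g := G (y k)) (g' := G (y (k + 1))) h.gamma_pos h.le_s h.one_le_tau'
    (le_afpT s τ k) h.eta_pos h.eta_mul_le
    (h.x_succ k) (h.z_succ k) (h.y_succ k) (h.coCoercive _ _) (h.coCoercive.mul_norm_sq_le hxs _)
  unfold pathEnergy errWeight
  rw [afpT_succ, add_sub_cancel_right]
  exact this

lemma norm_sub_sq_le (h : AdmissibleRun s γ η β τ G d u x y z) (k : ℕ) :
    ‖u k - G (y k)‖ ^ 2 ≤ 2 * ‖u k - G (y (k - d k))‖ ^ 2 +
      2 * (τ * ∑ j ∈ Finset.Ico (k - τ) k, ‖G (y (j + 1)) - G (y j)‖ ^ 2) := by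
  have h1 := norm_sub_sq_le_sum (f := fun j => G (y j)) (k := k) (h.delay_le k)
  have h2 : ‖u k - G (y k)‖ ≤ ‖u k - G (y (k - d k))‖ + ‖G (y (k - d k)) - G (y k)‖ :=
    norm_sub_le_norm_sub_add_norm_sub _ _ _
  have h3 : ‖u k - G (y k)‖ ^ 2 ≤ (‖u k - G (y (k - d k))‖ + ‖G (y (k - d k)) - G (y k)‖) ^ 2 := by
    gcongr
  nlinarith [sq_nonneg (‖u k - G (y (k - d k))‖ - ‖G (y (k - d k)) - G (y k)‖)]

lemma sum_errWeight_le (h : AdmissibleRun s γ η β τ G d u x y z) (j : ℕ) :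
    ∑ i ∈ Finset.range τ, errWeight s τ (j + 1 + i) ≤
      14 / 9 * (weight s τ (afpT s τ j) * (τ * errWeight s τ j)) := by
  refine le_trans (le_of_eq ?_) (sum_window_le h.one_lt_s h.one_le_tau (le_afpT s τ j))
  apply Finset.sum_congr rfl
  intro i _
  unfold errWeight afpT
  push_cast
  ring

/-- The summed Lyapunov inequality. -/
lemma energy_add_sum_le (h : AdmissibleRun s γ η β τ G d u x y z) {xs : E} (hxs : G xs = 0)
    (N : ℕ) :
    pathEnergy s γ η τ G y z xs N + ∑ k ∈ Finset.range N,
        (η / 2 * (s - 1 - γ) * (afpT s τ k * ‖G (y k)‖ ^ 2) +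
          5 / 8 * η * (errWeight s τ k * ‖G (y (k + 1)) - G (y k)‖ ^ 2)) ≤
      pathEnergy s γ η τ G y z xs 0 + 2 * η * errConst s γ / τ *
        ∑ k ∈ Finset.range N, errWeight s τ k * ‖u k - G (y (k - d k))‖ ^ 2 := by
  have hτ0 : (0 : ℝ) < τ := by linarith [h.one_le_tau']
  have hη := h.eta_pos
  have hK := errConst_pos h.gamma_pos h.le_s
  set Δ : ℕ → ℝ := fun j => ‖G (y (j + 1)) - G (y j)‖ ^ 2 with hΔ
  have key : ∀ N : ℕ, pathEnergy s γ η τ G y z xs N + ∑ k ∈ Finset.range N,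
      (η / 2 * (s - 1 - γ) * (afpT s τ k * ‖G (y k)‖ ^ 2) +
        η * (weight s τ (afpT s τ k) * errWeight s τ k) *
          ((7 / 3 * afpLambda s γ - 1) * τ + 5 / 8) * Δ k) ≤
      pathEnergy s γ η τ G y z xs 0 + 2 * η * errConst s γ / τ *
        (∑ k ∈ Finset.range N, errWeight s τ k * ‖u k - G (y (k - d k))‖ ^ 2) +
      2 * η * errConst s γ *
        ∑ k ∈ Finset.range N, errWeight s τ k * ∑ j ∈ Finset.Ico (k - τ) k, Δ j := by
    intro N
    induction N with
    | zero => simp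
    | succ n ih =>
      have h1 := h.energy_succ_le hxs n
      have h2 := mul_le_mul_of_nonneg_left (h.norm_sub_sq_le n)
        (by have := h.errWeight_pos n; positivity :
          0 ≤ η * (errConst s γ * (errWeight s τ n / τ)))
      simp only [Finset.sum_range_succ]
      have e : η * (errConst s γ * (errWeight s τ n / τ)) *
          (2 * ‖u n - G (y (n - d n))‖ ^ 2 + 2 * (τ * ∑ j ∈ Finset.Ico (n - τ) n, Δ j)) =
          2 * η * errConst s γ / τ * (errWeight s τ n * ‖u n - G (y (n - d n))‖ ^ 2) +
          2 * η * errConst s γ * (errWeight s τ n * ∑ j ∈ Finset.Ico (n - τ) n, Δ j) := by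
        field_simp
      rw [e] at h2
      linarith
  have hw := sum_mul_window_le (a := errWeight s τ) (f := Δ) (fun k => (h.errWeight_pos k).le)
    (fun k => sq_nonneg _) τ N
  have hw2 : ∑ j ∈ Finset.range N, Δ j * ∑ i ∈ Finset.range τ, errWeight s τ (j + 1 + i) ≤
      ∑ j ∈ Finset.range N, Δ j * (14 / 9 * (weight s τ (afpT s τ j) * (τ * errWeight s τ j))) :=
    Finset.sum_le_sum fun j _ => mul_le_mul_of_nonneg_left (h.sum_errWeight_le j) (sq_nonneg _)
  have hw3 := mul_le_mul_of_nonneg_left (hw.trans hw2) (by positivity : 0 ≤ 2 * η * errConst s γ)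
  -- The delay terms consume the part of the increment budget proportional to τ; the part 5/8
  -- survives.
  have hsum : 2 * η * errConst s γ * ∑ j ∈ Finset.range N,
      Δ j * (14 / 9 * (weight s τ (afpT s τ j) * (τ * errWeight s τ j))) +
      ∑ k ∈ Finset.range N, (η / 2 * (s - 1 - γ) * (afpT s τ k * ‖G (y k)‖ ^ 2) +
        5 / 8 * η * (errWeight s τ k * Δ k)) ≤
      ∑ k ∈ Finset.range N, (η / 2 * (s - 1 - γ) * (afpT s τ k * ‖G (y k)‖ ^ 2) +
        η * (weight s τ (afpT s τ k) * errWeight s τ k) *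
          ((7 / 3 * afpLambda s γ - 1) * τ + 5 / 8) * Δ k) := by
    rw [Finset.mul_sum, ← Finset.sum_add_distrib]
    apply Finset.sum_le_sum
    intro k _
    have hW := h.errWeight_pos k
    have hω := one_le_weight h.one_lt_s h.one_le_tau'
      (by linarith [le_afpT s τ k] : 3 * s + τ - 1 ≤ afpT s τ k)
    have hc := errConst_le' h.gamma_pos h.gamma_le h.le_s
    have hΔ0 : 0 ≤ Δ k := sq_nonneg _
    have hP : 0 ≤ η * Δ k * errWeight s τ k := by positivity
    have hP2 : 0 ≤ η * Δ k * errWeight s τ k * (weight s τ (afpT s τ k) * τ) := by positivity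
    nlinarith [mul_le_mul_of_nonneg_left hc hP2, mul_le_mul_of_nonneg_left hω hP]
  linarith [key N]

lemma inner_nonneg (h : AdmissibleRun s γ η β τ G d u x y z) {xs : E} (hxs : G xs = 0) (k : ℕ) :
    0 ≤ ⟪G (y k), y k - xs⟫ :=
  le_trans (by have := h.beta_pos; positivity) (h.coCoercive.mul_norm_sq_le hxs (y k))

lemma one_sub_pos (h : AdmissibleRun s γ η β τ G d u x y z) : 0 < 1 - γ / (s - 1) := by
  have h1 := h.le_s
  have h2 := h.gamma_pos
  rw [sub_pos, div_lt_one] <;> linarith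

/-- The accelerated rate along a run, in terms of the weighted squared errors. -/
lemma rate (h : AdmissibleRun s γ η β τ G d u x y z) {xs : E} (hxs : G xs = 0) (N : ℕ) :
    η / 4 * (N + 3 * s + τ - 1) ^ 2 * ‖G (y N)‖ ^ 2 ≤ afpRSq G s γ η τ (y 0) xs +
      2 * afpLambda s γ * η / τ *
        ∑ k ∈ Finset.range N, errWeight s τ k * ‖u k - G (y (k - d k))‖ ^ 2 := by
  have hX := h.one_sub_pos
  have hη := h.eta_pos
  have hτ0 : (0 : ℝ) < τ := by linarith [h.one_le_tau']
  have h1 := h.energy_add_sum_le hxs N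
  have h2 : pathEnergy s γ η τ G y z xs 0 ≤ (1 - γ / (s - 1)) * afpRSq G s γ η τ (y 0) xs := by
    have := energy_init_le (G := G) (y0 := y 0) (xs := xs) h.gamma_pos h.gamma_le h.le_s
      h.one_le_tau' hη h.eta_mul_le
      (by simpa [hxs] using h.coCoercive.mul_norm_sub_le (y 0) xs)
    unfold pathEnergy afpT
    rw [h.z_zero]
    simpa using this
  have h3 : (1 - γ / (s - 1)) * (η / 4 * (N + 3 * s + τ - 1) ^ 2 * ‖G (y N)‖ ^ 2) ≤
      pathEnergy s γ η τ G y z xs N :=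
    rate_le_energy h.gamma_pos h.le_s h.one_le_tau' (by linarith [le_afpT s τ N]) hη
      (h.inner_nonneg hxs N)
  have h4 : 0 ≤ ∑ k ∈ Finset.range N, (η / 2 * (s - 1 - γ) * (afpT s τ k * ‖G (y k)‖ ^ 2) +
      5 / 8 * η * (errWeight s τ k * ‖G (y (k + 1)) - G (y k)‖ ^ 2)) := by
    apply Finset.sum_nonneg
    intro k _
    have := h.errWeight_pos k
    have : 0 ≤ s - 1 - γ := by linarith [h.le_s, h.gamma_pos]
    have : 0 ≤ afpT s τ k := by linarith [le_afpT s τ k, h.one_lt_s]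
    positivity
  set S := ∑ k ∈ Finset.range N, errWeight s τ k * ‖u k - G (y (k - d k))‖ ^ 2
  have hS : 0 ≤ S := Finset.sum_nonneg fun k _ => by
    have := h.errWeight_pos k
    positivity
  have h5 : 2 * η * errConst s γ / τ * S ≤
      (1 - γ / (s - 1)) * (2 * afpLambda s γ * η / τ * S) := by
    calc 2 * η * errConst s γ / τ * S
        ≤ 2 * η * ((1 - γ / (s - 1)) * afpLambda s γ) / τ * S := by
          gcongr; exact errConst_le h.gamma_pos h.gamma_le h.le_s
      _ = _ := by ring
  -- The lower bound of the energy, its initial value and the error term all carry the factor 1 -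
  -- γ/(s-1), which is cancelled.
  refine le_of_mul_le_mul_left ?_ hX
  linarith

end AdmissibleRun

end Path

/-! ### Real sequences with summable perturbations. -/

section Sequences

lemma summable_of_le_sub_add {a b c : ℕ → ℝ} (ha : ∀ k, 0 ≤ a k) (hb : ∀ k, 0 ≤ b k)
    (hc0 : ∀ k, 0 ≤ c k) (hc : Summable c) (h : ∀ k, a (k + 1) ≤ a k - b k + c k) :
    Summable b := by
  have key : ∀ N, a N + ∑ k ∈ Finset.range N, b k ≤ a 0 + ∑ k ∈ Finset.range N, c k := by
    intro N
    induction N with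
    | zero => simp
    | succ n ih => rw [Finset.sum_range_succ, Finset.sum_range_succ]; linarith [h n]
  refine summable_of_sum_range_le (c := a 0 + ∑' k, c k) hb fun N => ?_
  have := hc.sum_le_tsum (Finset.range N) (fun k _ => hc0 k)
  linarith [key N, ha N]

lemma exists_tendsto_of_le_add {a c : ℕ → ℝ} (ha : ∀ k, 0 ≤ a k) (hc0 : ∀ k, 0 ≤ c k)
    (hc : Summable c) (h : ∀ k, a (k + 1) ≤ a k + c k) : ∃ l, Tendsto a atTop (𝓝 l) := by
  have hanti : Antitone fun k => a k - ∑ i ∈ Finset.range k, c i := by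
    refine antitone_nat_of_succ_le fun k => ?_
    rw [Finset.sum_range_succ]; linarith [h k]
  have hbdd : BddBelow (Set.range fun k => a k - ∑ i ∈ Finset.range k, c i) := by
    refine ⟨-∑' k, c k, ?_⟩
    rintro _ ⟨k, rfl⟩
    have := hc.sum_le_tsum (Finset.range k) (fun k _ => hc0 k)
    simp only
    linarith [ha k]
  have h1 := tendsto_atTop_ciInf hanti hbdd
  refine ⟨_, (h1.add hc.hasSum.tendsto_sum_nat).congr fun k => ?_⟩
  ring

/-- A positive limit would make the series dominate a multiple of the harmonic series. -/
lemma eq_zero_of_summable_div {a : ℕ → ℝ} {l c : ℝ} (hc : 0 < c) (ha : ∀ k, 0 ≤ a k)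
    (hl : Tendsto a atTop (𝓝 l)) (hs : Summable fun k : ℕ => a k / (k + c)) : l = 0 := by
  by_contra hne
  have hl0 : 0 < l := lt_of_le_of_ne (ge_of_tendsto' hl ha) (Ne.symm hne)
  obtain ⟨N, hN⟩ := (hl.eventually (lt_mem_nhds (half_lt_self hl0))).exists_forall_of_atTop
  obtain ⟨M, hM⟩ := exists_nat_ge c
  have h1 : Summable fun k : ℕ => a (k + N) / ((k + N : ℕ) + c) := (summable_nat_add_iff N).2 hs
  have h2 : Summable fun k : ℕ => (1 : ℝ) / ((k + (N + M) : ℕ) : ℝ) := by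
    refine Summable.of_nonneg_of_le (fun k => by positivity) (fun k => ?_) (h1.mul_left (2 / l))
    have hk := hN (k + N) (by omega)
    have hpos : (0 : ℝ) < (k + N : ℕ) + c := by positivity
    calc (1 : ℝ) / ((k + (N + M) : ℕ) : ℝ) ≤ 1 / ((k + N : ℕ) + c) := by
          apply one_div_le_one_div_of_le hpos
          push_cast; linarith
      _ = 2 / l * (l / 2 / ((k + N : ℕ) + c)) := by field_simp
      _ ≤ _ := by gcongr
  exact Real.not_summable_one_div_natCast ((summable_nat_add_iff (N + M)).1 h2)

end Sequences

/-! ### Convergence of a run whose weighted errors are summable. -/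

namespace AdmissibleRun

variable {E : Type*} [NormedAddCommGroup E] [InnerProductSpace ℝ E]
variable {s γ η β : ℝ} {τ : ℕ} {G : E → E} {d : ℕ → ℕ} {u x y z : ℕ → E} {xs : E}

lemma afpT_pos (h : AdmissibleRun s γ η β τ G d u x y z) (k : ℕ) : 0 < afpT s τ k := by
  linarith [le_afpT s τ k, h.one_lt_s, h.one_le_tau']

lemma one_le_afpT_sub (h : AdmissibleRun s γ η β τ G d u x y z) (k : ℕ) :
    1 ≤ afpT s τ k - s := by
  linarith [le_afpT s τ k, h.one_lt_s, h.one_le_tau']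

lemma afpT_le_errWeight (h : AdmissibleRun s γ η β τ G d u x y z) (k : ℕ) :
    afpT s τ k ≤ errWeight s τ k := by
  have h1 := h.afpT_pos k
  have h2 := h.one_le_afpT_sub k
  unfold errWeight
  nlinarith

lemma pathEnergy_nonneg (h : AdmissibleRun s γ η β τ G d u x y z) (hxs : G xs = 0) (k : ℕ) :
    0 ≤ pathEnergy s γ η τ G y z xs k :=
  le_trans (by have := h.eta_pos; positivity)
    (dist_le_energy h.gamma_pos h.le_s h.one_le_tau' (by linarith [le_afpT s τ k]) h.eta_pos
      (h.inner_nonneg hxs k))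

lemma sum_le (h : AdmissibleRun s γ η β τ G d u x y z) (hxs : G xs = 0)
    (he : Summable fun k => errWeight s τ k * ‖u k - G (y (k - d k))‖ ^ 2) :
    ∃ M : ℝ, 0 ≤ M ∧ ∀ N, pathEnergy s γ η τ G y z xs N ≤ M ∧
      ∑ k ∈ Finset.range N, (η / 2 * (s - 1 - γ) * (afpT s τ k * ‖G (y k)‖ ^ 2) +
        5 / 8 * η * (errWeight s τ k * ‖G (y (k + 1)) - G (y k)‖ ^ 2)) ≤ M := by
  have hη := h.eta_pos
  have hK := errConst_pos h.gamma_pos h.le_s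
  have hnn : ∀ k, 0 ≤ errWeight s τ k * ‖u k - G (y (k - d k))‖ ^ 2 := fun k => by
    have := h.errWeight_pos k
    positivity
  have hE0 := h.pathEnergy_nonneg hxs 0
  have hS : 0 ≤ ∑' k, errWeight s τ k * ‖u k - G (y (k - d k))‖ ^ 2 := tsum_nonneg hnn
  refine ⟨pathEnergy s γ η τ G y z xs 0 + 2 * η * errConst s γ / τ *
    ∑' k, errWeight s τ k * ‖u k - G (y (k - d k))‖ ^ 2, by positivity, fun N => ?_⟩
  have h1 := h.energy_add_sum_le hxs N
  have h2 := mul_le_mul_of_nonneg_left (he.sum_le_tsum (Finset.range N) (fun k _ => hnn k))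
    (by positivity : 0 ≤ 2 * η * errConst s γ / τ)
  have h3 := h.pathEnergy_nonneg hxs N
  have h4 : 0 ≤ ∑ k ∈ Finset.range N, (η / 2 * (s - 1 - γ) * (afpT s τ k * ‖G (y k)‖ ^ 2) +
      5 / 8 * η * (errWeight s τ k * ‖G (y (k + 1)) - G (y k)‖ ^ 2)) := by
    apply Finset.sum_nonneg
    intro k _
    have := h.errWeight_pos k
    have : 0 ≤ s - 1 - γ := by linarith [h.le_s, h.gamma_pos]
    have := h.afpT_pos k
    positivity
  constructor <;> linarith

lemma summable_gains (h : AdmissibleRun s γ η β τ G d u x y z) (hxs : G xs = 0)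
    (he : Summable fun k => errWeight s τ k * ‖u k - G (y (k - d k))‖ ^ 2) :
    (Summable fun k => afpT s τ k * ‖G (y k)‖ ^ 2) ∧
      Summable fun k => errWeight s τ k * ‖G (y (k + 1)) - G (y k)‖ ^ 2 := by
  obtain ⟨M, hM0, hM⟩ := h.sum_le hxs he
  have hη := h.eta_pos
  have hg0 : ∀ k, 0 ≤ afpT s τ k * ‖G (y k)‖ ^ 2 := fun k => by
    have := h.afpT_pos k
    positivity
  have hd0 : ∀ k, 0 ≤ errWeight s τ k * ‖G (y (k + 1)) - G (y k)‖ ^ 2 := fun k => by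
    have := h.errWeight_pos k
    positivity
  have hsγ : 0 < s - 1 - γ := by linarith [h.le_s, h.gamma_pos]
  have hc1 : 0 < η / 2 * (s - 1 - γ) := by positivity
  have hc2 : 0 < 5 / 8 * η := by positivity
  have hsum : Summable fun k => (η / 2 * (s - 1 - γ) * (afpT s τ k * ‖G (y k)‖ ^ 2) +
      5 / 8 * η * (errWeight s τ k * ‖G (y (k + 1)) - G (y k)‖ ^ 2)) :=
    summable_of_sum_range_le (fun k => by have := hg0 k; have := hd0 k; positivity)
      (fun N => (hM N).2)
  constructor
  · refine Summable.of_nonneg_of_le hg0 (fun k => ?_) (hsum.mul_left (η / 2 * (s - 1 - γ))⁻¹)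
    rw [mul_add, inv_mul_cancel_left₀ hc1.ne']
    have := hd0 k
    linarith [show 0 ≤ (η / 2 * (s - 1 - γ))⁻¹ * (5 / 8 * η * (errWeight s τ k *
      ‖G (y (k + 1)) - G (y k)‖ ^ 2)) by positivity]
  · refine Summable.of_nonneg_of_le hd0 (fun k => ?_) (hsum.mul_left (5 / 8 * η)⁻¹)
    rw [mul_add, inv_mul_cancel_left₀ hc2.ne']
    have := hg0 k
    linarith [show 0 ≤ (5 / 8 * η)⁻¹ * (η / 2 * (s - 1 - γ) * (afpT s τ k * ‖G (y k)‖ ^ 2)) by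
      positivity]

lemma summable_err (h : AdmissibleRun s γ η β τ G d u x y z) (hxs : G xs = 0)
    (he : Summable fun k => errWeight s τ k * ‖u k - G (y (k - d k))‖ ^ 2) :
    Summable fun k => errWeight s τ k * ‖u k - G (y k)‖ ^ 2 := by
  have hd := (h.summable_gains hxs he).2
  have hW := h.errWeight_pos
  set Δ : ℕ → ℝ := fun j => ‖G (y (j + 1)) - G (y j)‖ ^ 2 with hΔ
  have hΔ0 : ∀ k, 0 ≤ Δ k := fun k => sq_nonneg _
  have hwin : Summable fun k => errWeight s τ k * ∑ j ∈ Finset.Ico (k - τ) k, Δ j := by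
    have hnn : ∀ k, 0 ≤ errWeight s τ k * Δ k := fun k => mul_nonneg (hW k).le (hΔ0 k)
    -- Here 14/5 = 14/9 · 9/5, from `sum_window_le` and the bound 9/5 on the weight.
    refine summable_of_sum_range_le (c := 14 / 5 * τ * ∑' k, errWeight s τ k * Δ k)
      (fun k => mul_nonneg (hW k).le (Finset.sum_nonneg fun j _ => hΔ0 j)) fun N => ?_
    refine (sum_mul_window_le (fun k => (hW k).le) hΔ0 τ N).trans ?_
    calc ∑ j ∈ Finset.range N, Δ j * ∑ i ∈ Finset.range τ, errWeight s τ (j + 1 + i)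
        ≤ ∑ j ∈ Finset.range N, 14 / 5 * τ * (errWeight s τ j * Δ j) := by
          apply Finset.sum_le_sum
          intro j _
          have h1 := h.sum_errWeight_le j
          have h2 := weight_le h.one_lt_s h.one_le_tau'
            (by linarith [le_afpT s τ j] : 3 * s + τ - 1 ≤ afpT s τ j)
          have h3 : 0 ≤ τ * errWeight s τ j := mul_nonneg (by positivity) (hW j).le
          calc Δ j * ∑ i ∈ Finset.range τ, errWeight s τ (j + 1 + i)
              ≤ Δ j * (14 / 9 * (9 / 5 * (τ * errWeight s τ j))) :=
                mul_le_mul_of_nonneg_left (h1.trans (by gcongr)) (hΔ0 j)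
            _ = _ := by ring
      _ ≤ _ := by
          rw [← Finset.mul_sum]
          gcongr
          exact hd.sum_le_tsum _ fun k _ => hnn k
  refine Summable.of_nonneg_of_le (fun k => mul_nonneg (hW k).le (sq_nonneg _)) (fun k => ?_)
    ((he.mul_left 2).add (hwin.mul_left (2 * (τ : ℝ))))
  have := mul_le_mul_of_nonneg_left (h.norm_sub_sq_le k) (hW k).le
  refine this.trans (le_of_eq ?_)
  ring

lemma summable_norm_estimate (h : AdmissibleRun s γ η β τ G d u x y z) (hxs : G xs = 0)
    (he : Summable fun k => errWeight s τ k * ‖u k - G (y (k - d k))‖ ^ 2) :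
    Summable fun k => afpT s τ k * ‖u k‖ ^ 2 := by
  have h1 := h.summable_err hxs he
  have h2 := (h.summable_gains hxs he).1
  have hT := h.afpT_pos
  refine Summable.of_nonneg_of_le (fun k => mul_nonneg (hT k).le (sq_nonneg _)) (fun k => ?_)
    ((h1.mul_left 2).add (h2.mul_left 2))
  have h3 : ‖u k‖ ≤ ‖u k - G (y k)‖ + ‖G (y k)‖ := by
    simpa using norm_add_le (u k - G (y k)) (G (y k))
  have h4 : ‖u k‖ ^ 2 ≤ 2 * ‖u k - G (y k)‖ ^ 2 + 2 * ‖G (y k)‖ ^ 2 := by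
    have : ‖u k‖ ^ 2 ≤ (‖u k - G (y k)‖ + ‖G (y k)‖) ^ 2 := by gcongr
    nlinarith [sq_nonneg (‖u k - G (y k)‖ - ‖G (y k)‖)]
  have h5 := mul_le_mul_of_nonneg_left h4 (hT k).le
  have h6 := mul_le_mul_of_nonneg_right (h.afpT_le_errWeight k) (sq_nonneg ‖u k - G (y k)‖)
  linarith

lemma diff_succ (h : AdmissibleRun s γ η β τ G d u x y z) (k : ℕ) :
    y (k + 1) - z (k + 1) = ((afpT s τ k - s) / afpT s τ k) • (y k - z k) -
      (η / 2 * (1 - γ / s)) • u k := by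
  have hT : afpT s τ k ≠ 0 := (h.afpT_pos k).ne'
  have hTs : afpT s τ k - s ≠ 0 := by linarith [h.one_le_afpT_sub k]
  have hx : x (k + 1) - y k = -(afpStep s η τ k • u k) := by rw [h.x_succ]; abel
  have hx' : x (k + 1) = y k - afpStep s η τ k • u k := h.x_succ k
  have hs : s / afpT s τ k = 1 - (afpT s τ k - s) / afpT s τ k := by field_simp; ring
  have hc : η / 2 = (afpT s τ k - s) / afpT s τ k * afpStep s η τ k := by
    unfold afpStep; field_simp
  rw [h.y_succ, hs, h.z_succ, hx, hx', hc]
  module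

lemma norm_diff_sq_succ_le (h : AdmissibleRun s γ η β τ G d u x y z) (k : ℕ) :
    ‖y (k + 1) - z (k + 1)‖ ^ 2 ≤ ‖y k - z k‖ ^ 2 - s * (‖y k - z k‖ ^ 2 / afpT s τ k) +
      η ^ 2 * (afpT s τ k * ‖u k‖ ^ 2) := by
  have hT := h.afpT_pos k
  have hs := h.one_lt_s
  have hs0 : 0 < s := by linarith
  have hTs : 0 < afpT s τ k - s := by linarith [h.one_le_afpT_sub k]
  have hη := h.eta_pos
  have hγs : 0 ≤ 1 - γ / s := by
    rw [sub_nonneg, div_le_one hs0]; linarith [h.gamma_le]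
  have hγs1 : 1 - γ / s ≤ 1 := by
    have := div_pos h.gamma_pos hs0
    linarith
  have h1 : ‖y (k + 1) - z (k + 1)‖ ≤
      (afpT s τ k - s) / afpT s τ k * ‖y k - z k‖ + η * ‖u k‖ := by
    rw [h.diff_succ k]
    refine (norm_sub_le _ _).trans ?_
    rw [norm_smul, norm_smul, Real.norm_of_nonneg (by positivity),
      Real.norm_of_nonneg (by positivity)]
    gcongr
    nlinarith
  have h2 : ‖y (k + 1) - z (k + 1)‖ ^ 2 ≤
      ((afpT s τ k - s) / afpT s τ k * ‖y k - z k‖ + η * ‖u k‖) ^ 2 := by gcongr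
  refine h2.trans ?_
  generalize ‖y k - z k‖ = a
  generalize ‖u k‖ = b
  generalize afpT s τ k = t at *
  -- Convexity of the square: the right side of `h1` is the average of a and ηbt/s with weights 1 -
  -- s/t and s/t. The remaining factor 1/s is at most 1.
  have key : a ^ 2 - s * (a ^ 2 / t) + η ^ 2 * (t * b ^ 2) -
      ((t - s) / t * a + η * b) ^ 2 = ((t - s) * s * (a - η * b * t / s) ^ 2 / t ^ 2 +
        (1 - 1 / s) * (η ^ 2 * t * b ^ 2)) := by
    field_simp
    ring
  have : 0 ≤ 1 - 1 / s := by
    rw [sub_nonneg, div_le_one hs0]; linarith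
  have : 0 ≤ (t - s) * s * (a - η * b * t / s) ^ 2 / t ^ 2 +
        (1 - 1 / s) * (η ^ 2 * t * b ^ 2) := by positivity
  linarith

lemma summable_diff_div (h : AdmissibleRun s γ η β τ G d u x y z) (hxs : G xs = 0)
    (he : Summable fun k => errWeight s τ k * ‖u k - G (y (k - d k))‖ ^ 2) :
    Summable fun k => ‖y k - z k‖ ^ 2 / afpT s τ k := by
  have hs0 : 0 < s := by linarith [h.one_lt_s]
  have := summable_of_le_sub_add (a := fun k => ‖y k - z k‖ ^ 2)
    (b := fun k => s * (‖y k - z k‖ ^ 2 / afpT s τ k))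
    (c := fun k => η ^ 2 * (afpT s τ k * ‖u k‖ ^ 2)) (fun k => sq_nonneg _)
    (fun k => by have := h.afpT_pos k; positivity) (fun k => by have := h.afpT_pos k; positivity)
    ((h.summable_norm_estimate hxs he).mul_left _) h.norm_diff_sq_succ_le
  exact (summable_mul_left_iff hs0.ne').1 this

/-- The squared norms converge, being decreasing up to summable terms, and their quotients by t are
summable, so the limit is 0. -/
lemma tendsto_diff (h : AdmissibleRun s γ η β τ G d u x y z) (hxs : G xs = 0)
    (he : Summable fun k => errWeight s τ k * ‖u k - G (y (k - d k))‖ ^ 2) :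
    Tendsto (fun k => y k - z k) atTop (𝓝 0) := by
  have hs0 : 0 < s := by linarith [h.one_lt_s]
  obtain ⟨l, hl⟩ := exists_tendsto_of_le_add (a := fun k => ‖y k - z k‖ ^ 2)
    (c := fun k => η ^ 2 * (afpT s τ k * ‖u k‖ ^ 2)) (fun k => sq_nonneg _)
    (fun k => by have := h.afpT_pos k; positivity)
    ((h.summable_norm_estimate hxs he).mul_left _) (fun k => by
      have h1 := h.norm_diff_sq_succ_le k
      have : 0 ≤ s * (‖y k - z k‖ ^ 2 / afpT s τ k) := by
        have := h.afpT_pos k; positivity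
      linarith)
  have hl0 : l = 0 := by
    refine eq_zero_of_summable_div (c := 3 * s + τ) (by positivity) (fun k => sq_nonneg _) hl ?_
    refine (h.summable_diff_div hxs he).congr fun k => ?_
    unfold afpT
    rw [add_assoc]
  subst hl0
  rw [tendsto_zero_iff_norm_tendsto_zero]
  have := (Real.continuous_sqrt.tendsto 0).comp hl
  simpa [Function.comp_def, Real.sqrt_sq] using this

end AdmissibleRun

namespace AdmissibleRun

variable {E : Type*} [NormedAddCommGroup E] [InnerProductSpace ℝ E]
variable {s γ η β : ℝ} {τ : ℕ} {G : E → E} {d : ℕ → ℕ} {u x y z : ℕ → E} {xs : E}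

lemma summable_inv_errWeight (h : AdmissibleRun s γ η β τ G d u x y z) :
    Summable fun k => (errWeight s τ k)⁻¹ := by
  have h1 : Summable fun k : ℕ => 1 / ((k + 1 : ℕ) : ℝ) ^ 2 :=
    (summable_nat_add_iff 1).2 (Real.summable_one_div_nat_pow.2 one_lt_two)
  refine Summable.of_nonneg_of_le (fun k => (inv_pos.2 (h.errWeight_pos k)).le) (fun k => ?_) h1
  rw [← one_div]
  apply one_div_le_one_div_of_le (by positivity)
  have h2 := h.one_lt_s
  have h3 := h.one_le_tau'
  unfold errWeight afpT
  push_cast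
  rw [sq]
  have : (0 : ℝ) ≤ k := by positivity
  apply mul_le_mul <;> linarith

lemma afpStep_mem (h : AdmissibleRun s γ η β τ G d u x y z) (k : ℕ) :
    0 ≤ afpStep s η τ k ∧ afpStep s η τ k ≤ η := by
  have hT := h.afpT_pos k
  have hTs : 0 < afpT s τ k - s := by linarith [h.one_le_afpT_sub k]
  have hη := h.eta_pos
  unfold afpStep
  refine ⟨by positivity, ?_⟩
  rw [div_le_iff₀ (by positivity)]
  have : afpT s τ k ≤ 2 * (afpT s τ k - s) := by
    linarith [le_afpT s τ k, h.one_lt_s, h.one_le_tau']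
  nlinarith

/-- Up to the nonnegative term ⟪G y, y - x⋆⟫, the pairing ⟪u, z - x⋆⟫ consists of ⟪G y, y - z⟫,
split with weight t, and ⟪u - G y, z - x⋆⟫, split with weight t(t-s). The latter is summable because
z is already known to be bounded and Σ 1/(t(t-s)) converges. -/
lemma exists_tendsto_norm_sub_sq (h : AdmissibleRun s γ η β τ G d u x y z) (hxs : G xs = 0)
    (he : Summable fun k => errWeight s τ k * ‖u k - G (y (k - d k))‖ ^ 2) :
    ∃ l, Tendsto (fun k => ‖z k - xs‖ ^ 2) atTop (𝓝 l) := by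
  obtain ⟨M, hM0, hM⟩ := h.sum_le hxs he
  have hη := h.eta_pos
  have hs0 : 0 < s := by linarith [h.one_lt_s]
  have hγ := h.gamma_pos
  set M' := η / s ^ 2 * M with hM'
  have hM'0 : 0 ≤ M' := by positivity
  have hv : ∀ k, ‖z k - xs‖ ^ 2 ≤ M' := by
    intro k
    have h1 := dist_le_energy (z := z k) h.gamma_pos h.le_s h.one_le_tau'
      (by linarith [le_afpT s τ k] : 3 * s + τ - 1 ≤ afpT s τ k - 1) h.eta_pos
      (h.inner_nonneg hxs k)
    have h2 : s ^ 2 / η * ‖z k - xs‖ ^ 2 ≤ M := h1.trans (hM k).1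
    calc ‖z k - xs‖ ^ 2 = η / s ^ 2 * (s ^ 2 / η * ‖z k - xs‖ ^ 2) := by field_simp
      _ ≤ _ := by rw [hM']; gcongr
  refine exists_tendsto_of_le_add
    (c := fun k => η * (afpT s τ k * ‖G (y k)‖ ^ 2 + ‖y k - z k‖ ^ 2 / afpT s τ k +
      errWeight s τ k * ‖u k - G (y k)‖ ^ 2 + M' * (errWeight s τ k)⁻¹) +
      η ^ 2 * (afpT s τ k * ‖u k‖ ^ 2)) (fun k => sq_nonneg _) (fun k => ?_) ?_ (fun k => ?_)
  · have := h.afpT_pos k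
    have := h.errWeight_pos k
    positivity
  · exact (((((h.summable_gains hxs he).1.add (h.summable_diff_div hxs he)).add
      (h.summable_err hxs he)).add (h.summable_inv_errWeight.mul_left M')).mul_left η).add
      ((h.summable_norm_estimate hxs he).mul_left _)
  · have hT := h.afpT_pos k
    have hW := h.errWeight_pos k
    obtain ⟨hst0, hst1⟩ := h.afpStep_mem k
    set κ := γ / s * afpStep s η τ k with hκ
    have hκ0 : 0 ≤ κ := by positivity
    have hκ1 : κ ≤ η := by
      have : γ / s ≤ 1 := by
        rw [div_le_one hs0]; linarith [h.gamma_le, h.one_lt_s]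
      calc κ ≤ 1 * η := by rw [hκ]; gcongr
        _ = η := one_mul η
    have hz : z (k + 1) - xs = (z k - xs) - κ • u k := by
      rw [h.z_succ, h.x_succ, hκ]; module
    have e1 : ‖z (k + 1) - xs‖ ^ 2 =
        ‖z k - xs‖ ^ 2 - 2 * (κ * ⟪u k, z k - xs⟫) + κ ^ 2 * ‖u k‖ ^ 2 := by
      rw [hz, norm_sub_sq_real, inner_smul_right, norm_smul, mul_pow, Real.norm_eq_abs, sq_abs,
        real_inner_comm]
    have e2 : ⟪u k, z k - xs⟫ = ⟪G (y k), y k - xs⟫ - ⟪G (y k), y k - z k⟫ +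
        ⟪u k - G (y k), z k - xs⟫ := by
      rw [inner_sub_left, ← inner_sub_right, sub_sub_sub_cancel_left, add_sub_cancel]
    have y1 := neg_young_le_mul_inner (by positivity : 0 < afpT s τ k / 2) (-1)
      (G (y k)) (y k - z k)
    have y2 := neg_young_le_mul_inner (by positivity : 0 < errWeight s τ k / 2) 1
      (u k - G (y k)) (z k - xs)
    have hmono := h.inner_nonneg hxs k
    have y3 : -(1 / 2 * (afpT s τ k * ‖G (y k)‖ ^ 2 + ‖y k - z k‖ ^ 2 / afpT s τ k +
        errWeight s τ k * ‖u k - G (y k)‖ ^ 2 + M' * (errWeight s τ k)⁻¹)) ≤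
        ⟪u k, z k - xs⟫ := by
      have e3 : (-1 : ℝ) ^ 2 / (4 * (afpT s τ k / 2)) * ‖y k - z k‖ ^ 2 =
          1 / 2 * (‖y k - z k‖ ^ 2 / afpT s τ k) := by field_simp; norm_num
      have e4 : (1 : ℝ) ^ 2 / (4 * (errWeight s τ k / 2)) * ‖z k - xs‖ ^ 2 =
          1 / 2 * (‖z k - xs‖ ^ 2 * (errWeight s τ k)⁻¹) := by field_simp; norm_num
      rw [e3] at y1
      rw [e4] at y2
      have := mul_le_mul_of_nonneg_right (hv k) (inv_pos.2 hW).le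
      linarith
    set B := afpT s τ k * ‖G (y k)‖ ^ 2 + ‖y k - z k‖ ^ 2 / afpT s τ k +
        errWeight s τ k * ‖u k - G (y k)‖ ^ 2 + M' * (errWeight s τ k)⁻¹ with hB
    have hB0 : 0 ≤ B := by positivity
    have h3 := mul_le_mul_of_nonneg_left y3 hκ0
    have h4 : κ * B ≤ η * B := by gcongr
    have h5 : κ ^ 2 * ‖u k‖ ^ 2 ≤ η ^ 2 * (afpT s τ k * ‖u k‖ ^ 2) := by
      have : 1 ≤ afpT s τ k := by linarith [h.one_le_afpT_sub k]
      have : κ ^ 2 ≤ η ^ 2 * afpT s τ k := by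
        calc κ ^ 2 ≤ η ^ 2 := by gcongr
          _ ≤ _ := le_mul_of_one_le_right (by positivity) this
      calc κ ^ 2 * ‖u k‖ ^ 2 ≤ η ^ 2 * afpT s τ k * ‖u k‖ ^ 2 := by gcongr
        _ = _ := by ring
    rw [e1]
    linarith

lemma tendsto_afpT (s : ℝ) (τ : ℕ) : Tendsto (fun k => afpT s τ k) atTop atTop := by
  unfold afpT
  exact tendsto_atTop_add_const_right _ _
    (tendsto_atTop_add_const_right _ _ tendsto_natCast_atTop_atTop)

lemma tendsto_weight (s : ℝ) (τ : ℕ) :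
    Tendsto (fun k => weight s τ (afpT s τ k - 1)) atTop (𝓝 1) := by
  have h1 : Tendsto (fun k => afpT s τ k - 2 - weightShift s τ) atTop atTop := by
    simp only [sub_eq_add_neg]
    exact tendsto_atTop_add_const_right _ _ (tendsto_atTop_add_const_right _ _ (tendsto_afpT s τ))
  have h2 : Tendsto (fun k => 1 + weightShift s τ / (afpT s τ k - 2 - weightShift s τ)) atTop
      (𝓝 (1 + 0)) := tendsto_const_nhds.add (h1.const_div_atTop _)
  rw [add_zero] at h2
  refine h2.congr' ?_
  filter_upwards [h1.eventually_gt_atTop 0] with k hk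
  unfold weight
  rw [show afpT s τ k - 1 - 1 - weightShift s τ = afpT s τ k - 2 - weightShift s τ by ring]
  field_simp
  ring

lemma exists_tendsto_distCoeff (h : AdmissibleRun s γ η β τ G d u x y z) :
    ∃ l, Tendsto (fun k => distCoeff s τ (afpT s τ k - 1)) atTop (𝓝 l) := by
  have hs := h.one_lt_s
  have hτ := h.one_le_tau'
  refine ⟨_, tendsto_atTop_ciInf (antitone_nat_of_succ_le fun k => ?_) ⟨s - 1, ?_⟩⟩
  · rw [afpT_succ, add_sub_cancel_right]
    linarith [distCoeff_sub_pos hs hτ (le_afpT s τ k)]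
  · rintro _ ⟨k, rfl⟩
    exact le_distCoeff hs hτ (by linarith [le_afpT s τ k])

lemma exists_tendsto_pathEnergy (h : AdmissibleRun s γ η β τ G d u x y z) (hxs : G xs = 0)
    (he : Summable fun k => errWeight s τ k * ‖u k - G (y (k - d k))‖ ^ 2) :
    ∃ l, Tendsto (pathEnergy s γ η τ G y z xs) atTop (𝓝 l) := by
  have hη := h.eta_pos
  have hK := errConst_pos h.gamma_pos h.le_s
  refine exists_tendsto_of_le_add (c := fun k => η * errConst s γ / τ *
    (errWeight s τ k * ‖u k - G (y k)‖ ^ 2)) (h.pathEnergy_nonneg hxs)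
    (fun k => by have := h.errWeight_pos k; positivity) ((h.summable_err hxs he).mul_left _)
    fun k => ?_
  have h1 := h.energy_succ_le hxs k
  have h2 : 0 ≤ η / 2 * (s - 1 - γ) * (afpT s τ k * ‖G (y k)‖ ^ 2) := by
    have := h.afpT_pos k
    have : 0 ≤ s - 1 - γ := by linarith [h.le_s, h.gamma_pos]
    positivity
  have h3 : 0 ≤ η * (weight s τ (afpT s τ k) * errWeight s τ k) *
        ((7 / 3 * afpLambda s γ - 1) * τ + 5 / 8) * ‖G (y (k + 1)) - G (y k)‖ ^ 2 := by
    have h4 : 0 ≤ 7 / 3 * afpLambda s γ - 1 := by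
      unfold afpLambda; linarith [h.one_lt_s, h.gamma_le]
    have h5 : 0 ≤ weight s τ (afpT s τ k) := by
      linarith [one_le_weight h.one_lt_s h.one_le_tau'
        (by linarith [le_afpT s τ k] : 3 * s + τ - 1 ≤ afpT s τ k)]
    have := h.errWeight_pos k
    positivity
  have e : η * (errConst s γ * (errWeight s τ k / τ)) * ‖u k - G (y k)‖ ^ 2 =
      η * errConst s γ / τ * (errWeight s τ k * ‖u k - G (y k)‖ ^ 2) := by ring
  linarith

lemma summable_rate (h : AdmissibleRun s γ η β τ G d u x y z) (hxs : G xs = 0)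
    (he : Summable fun k => errWeight s τ k * ‖u k - G (y (k - d k))‖ ^ 2) :
    Summable fun k : ℕ => ((k : ℝ) + τ) * ‖G (y k)‖ ^ 2 := by
  refine Summable.of_nonneg_of_le (fun k => by positivity) (fun k => ?_)
    (h.summable_gains hxs he).1
  gcongr
  unfold afpT
  linarith [h.one_lt_s]

/-- In the energy everything but the gradient term converges: the mixed term tends to 0, since t‖g‖
is bounded and y - z → 0. So t²‖g‖² converges, and summability of t‖g‖² makes the limit 0. -/
lemma tendsto_sq_mul (h : AdmissibleRun s γ η β τ G d u x y z) (hxs : G xs = 0)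
    (he : Summable fun k => errWeight s τ k * ‖u k - G (y (k - d k))‖ ^ 2) :
    Tendsto (fun k => (afpT s τ k - 1) ^ 2 * ‖G (y k)‖ ^ 2) atTop (𝓝 0) := by
  obtain ⟨M, hM0, hM⟩ := h.sum_le hxs he
  obtain ⟨lE, hE⟩ := h.exists_tendsto_pathEnergy hxs he
  obtain ⟨lv, hv⟩ := h.exists_tendsto_norm_sub_sq hxs he
  obtain ⟨lq, hq⟩ := h.exists_tendsto_distCoeff
  have hω := tendsto_weight s τ
  have hX := h.one_sub_pos
  have hη := h.eta_pos
  have hT1 : ∀ k, 0 < afpT s τ k - 1 := fun k => by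
    linarith [h.one_le_afpT_sub k, h.one_lt_s]
  have hbd : ∀ k, (afpT s τ k - 1) * ‖G (y k)‖ ≤
      √(M / ((1 - γ / (s - 1)) * (η / 4))) := by
    intro k
    apply Real.le_sqrt_of_sq_le
    rw [le_div_iff₀ (by positivity)]
    have := rate_le_energy (z := z k) h.gamma_pos h.le_s h.one_le_tau'
      (by linarith [le_afpT s τ k] : 3 * s + τ - 1 ≤ afpT s τ k - 1) hη (h.inner_nonneg hxs k)
    refine le_trans (le_of_eq ?_) (this.trans (hM k).1)
    ring
  have hcross : Tendsto (fun k => (afpT s τ k - 1) * ⟪G (y k), y k - z k⟫) atTop (𝓝 0) := by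
    have h0 := ((h.tendsto_diff hxs he).norm).const_mul (√(M / ((1 - γ / (s - 1)) * (η / 4))))
    rw [norm_zero, mul_zero] at h0
    refine squeeze_zero_norm (fun k => ?_) h0
    rw [norm_mul, Real.norm_of_nonneg (hT1 k).le]
    calc (afpT s τ k - 1) * ‖⟪G (y k), y k - z k⟫‖
        ≤ (afpT s τ k - 1) * (‖G (y k)‖ * ‖y k - z k‖) := by
          have := norm_inner_le_norm (𝕜 := ℝ) (G (y k)) (y k - z k)
          have := (hT1 k).le
          gcongr
      _ = ((afpT s τ k - 1) * ‖G (y k)‖) * ‖y k - z k‖ := by ring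
      _ ≤ _ := by gcongr; exact hbd k
  have hlim : Tendsto (fun k => (pathEnergy s γ η τ G y z xs k -
      s * weight s τ (afpT s τ k - 1) * ((afpT s τ k - 1) * ⟪G (y k), y k - z k⟫) -
      s ^ 2 * distCoeff s τ (afpT s τ k - 1) / (γ * η) * ‖z k - xs‖ ^ 2) /
      (η / 4 * weight s τ (afpT s τ k - 1))) atTop
      (𝓝 ((lE - s * 1 * 0 - s ^ 2 * lq / (γ * η) * lv) / (η / 4 * 1))) :=
    ((hE.sub ((hω.const_mul s).mul hcross)).sub
      (((hq.const_mul (s ^ 2)).div_const (γ * η)).mul hv)).div (hω.const_mul (η / 4))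
      (by positivity)
  set l := (lE - s * 1 * 0 - s ^ 2 * lq / (γ * η) * lv) / (η / 4 * 1)
  have hP : Tendsto (fun k => (afpT s τ k - 1) ^ 2 * ‖G (y k)‖ ^ 2) atTop (𝓝 l) := by
    refine hlim.congr fun k => ?_
    have hω0 : 0 < weight s τ (afpT s τ k - 1) := by
      linarith [one_le_weight h.one_lt_s h.one_le_tau'
        (by linarith [le_afpT s τ k] : 3 * s + τ - 1 ≤ afpT s τ k - 1)]
    unfold pathEnergy energy
    field_simp
    ring
  have hl : l = 0 := by
    have hs0 : 0 < s := by linarith [h.one_lt_s]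
    refine eq_zero_of_summable_div (c := 3 * s + τ) (by positivity) (fun k => by positivity) hP ?_
    refine Summable.of_nonneg_of_le (fun k => by positivity) (fun k => ?_)
      (h.summable_gains hxs he).1
    have hT := h.afpT_pos k
    rw [show (k : ℝ) + (3 * s + τ) = afpT s τ k by unfold afpT; ring, div_le_iff₀ hT]
    have : (afpT s τ k - 1) ^ 2 ≤ afpT s τ k ^ 2 := by
      have := hT1 k
      gcongr
      linarith
    nlinarith [mul_le_mul_of_nonneg_right this (sq_nonneg ‖G (y k)‖)]
  rwa [hl] at hP

lemma tendsto_rate (h : AdmissibleRun s γ η β τ G d u x y z) (hxs : G xs = 0)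
    (he : Summable fun k => errWeight s τ k * ‖u k - G (y (k - d k))‖ ^ 2) :
    Tendsto (fun k : ℕ => ((k : ℝ) + τ) ^ 2 * ‖G (y k)‖ ^ 2) atTop (𝓝 0) := by
  refine squeeze_zero (fun k => by positivity) (fun k => ?_) (h.tendsto_sq_mul hxs he)
  gcongr
  unfold afpT
  linarith [h.one_lt_s]

lemma tendsto_norm_zero_of_summable {v : ℕ → E} (h : AdmissibleRun s γ η β τ G d u x y z)
    (hv : Summable fun k => afpT s τ k * ‖v k‖ ^ 2) : Tendsto v atTop (𝓝 0) := by
  rw [tendsto_zero_iff_norm_tendsto_zero]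
  have h1 : Tendsto (fun k => ‖v k‖ ^ 2) atTop (𝓝 0) := by
    refine squeeze_zero (fun k => sq_nonneg _) (fun k => ?_) hv.tendsto_atTop_zero
    have := h.one_le_afpT_sub k
    exact le_mul_of_one_le_left (sq_nonneg _) (by linarith [h.one_lt_s])
  simpa [Function.comp_def, Real.sqrt_sq] using (Real.continuous_sqrt.tendsto 0).comp h1

lemma continuous_of_run (h : AdmissibleRun s γ η β τ G d u x y z) : Continuous G := by
  have hβ := h.beta_pos
  refine LipschitzWith.continuous (K := ⟨β⁻¹, by positivity⟩)
    (LipschitzWith.of_dist_le_mul fun a b => ?_)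
  rw [dist_eq_norm, dist_eq_norm]
  have := h.coCoercive.mul_norm_sub_le a b
  calc ‖G a - G b‖ = β⁻¹ * (β * ‖G a - G b‖) := by field_simp
    _ ≤ β⁻¹ * ‖a - b‖ := by gcongr

/-- The iterates of a run converge to a common zero of the operator. -/
lemma exists_limit [FiniteDimensional ℝ E] (h : AdmissibleRun s γ η β τ G d u x y z)
    (hxs : G xs = 0) (he : Summable fun k => errWeight s τ k * ‖u k - G (y (k - d k))‖ ^ 2) :
    ∃ a, G a = 0 ∧ Tendsto x atTop (𝓝 a) ∧ Tendsto y atTop (𝓝 a) ∧ Tendsto z atTop (𝓝 a) := by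
  have : ProperSpace E := FiniteDimensional.proper ℝ E
  have hw := h.tendsto_diff hxs he
  have hg := h.tendsto_norm_zero_of_summable (h.summable_gains hxs he).1
  have hu := h.tendsto_norm_zero_of_summable (h.summable_norm_estimate hxs he)
  obtain ⟨l, hl⟩ := h.exists_tendsto_norm_sub_sq hxs he
  obtain ⟨C, hC⟩ := hl.bddAbove_range
  have hball : ∀ k, z k ∈ Metric.closedBall xs (√C) := fun k => by
    rw [mem_closedBall_iff_norm]
    exact Real.le_sqrt_of_sq_le (hC ⟨k, rfl⟩)
  obtain ⟨a, -, φ, hφ, ha⟩ := tendsto_subseq_of_bounded Metric.isBounded_closedBall hball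
  have hya : Tendsto (y ∘ φ) atTop (𝓝 a) := by
    have := (hw.comp hφ.tendsto_atTop).add ha
    simpa [Function.comp_def] using this
  have hGa : G a = 0 :=
    tendsto_nhds_unique ((h.continuous_of_run.tendsto a).comp hya) (hg.comp hφ.tendsto_atTop)
  -- Opial's argument: the distance to the cluster point a, itself a zero, also converges, and it
  -- tends to 0 along the subsequence.
  obtain ⟨l', hl'⟩ := h.exists_tendsto_norm_sub_sq hGa he
  have hl'0 : l' = 0 := by
    have h1 : Tendsto (fun k => ‖z (φ k) - a‖ ^ 2) atTop (𝓝 (‖a - a‖ ^ 2)) :=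
      ((ha.sub_const a).norm).pow 2
    have := tendsto_nhds_unique (hl'.comp hφ.tendsto_atTop) h1
    simpa using this
  subst hl'0
  have hz : Tendsto z atTop (𝓝 a) := by
    rw [tendsto_iff_norm_sub_tendsto_zero]
    simpa [Function.comp_def, Real.sqrt_sq] using (Real.continuous_sqrt.tendsto 0).comp hl'
  have hy : Tendsto y atTop (𝓝 a) := by simpa using hw.add hz
  have hst : Tendsto (fun k => afpStep s η τ k • u k) atTop (𝓝 0) := by
    have h0 := hu.norm.const_mul η
    rw [norm_zero, mul_zero] at h0
    refine squeeze_zero_norm (fun k => ?_) h0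
    rw [norm_smul, Real.norm_of_nonneg (h.afpStep_mem k).1]
    have := (h.afpStep_mem k).2
    gcongr
  refine ⟨a, hGa, ?_, hy, hz⟩
  rw [← tendsto_add_atTop_iff_nat 1]
  have := hy.sub hst
  rw [sub_zero] at this
  exact this.congr fun k => (h.x_succ k).symm

end AdmissibleRun

/-! ### From single runs to expectations and almost sure statements. -/

section Integral

variable {Ω : Type*} [MeasurableSpace Ω] {P : Measure Ω}

/-- Tonelli's theorem for the extended nonnegative sum. Its finite part S serves as a majorant,
uniform in N, for dominated convergence. -/
lemma exists_integrable_bound_sum {f : ℕ → Ω → ℝ} (hf0 : ∀ k ω, 0 ≤ f k ω)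
    (hf : ∀ k, Integrable (f k) P) (hs : Summable fun k => ∫ ω, f k ω ∂P) :
    ∃ S : Ω → ℝ, Integrable S P ∧
      ∀ᵐ ω ∂P, Summable (fun k => f k ω) ∧ ∀ N, ∑ k ∈ Finset.range N, f k ω ≤ S ω := by
  have hm : ∀ k, AEMeasurable (fun ω => ENNReal.ofReal (f k ω)) P :=
    fun k => (hf k).aemeasurable.ennreal_ofReal
  have hfin : ∫⁻ ω, ∑' k, ENNReal.ofReal (f k ω) ∂P ≠ ⊤ := by
    rw [lintegral_tsum hm]
    have : ∀ k, ∫⁻ ω, ENNReal.ofReal (f k ω) ∂P = ENNReal.ofReal (∫ ω, f k ω ∂P) := fun k =>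
      (ofReal_integral_eq_lintegral_ofReal (hf k) (Eventually.of_forall (hf0 k))).symm
    simp_rw [this]
    exact hs.tsum_ofReal_ne_top
  have hmS : AEMeasurable (fun ω => ∑' k, ENNReal.ofReal (f k ω)) P := AEMeasurable.tsum hm
  refine ⟨fun ω => (∑' k, ENNReal.ofReal (f k ω)).toReal,
    integrable_toReal_of_lintegral_ne_top hmS hfin, ?_⟩
  filter_upwards [ae_lt_top' hmS hfin] with ω hω
  have hbd : ∀ N, ∑ k ∈ Finset.range N, f k ω ≤ (∑' k, ENNReal.ofReal (f k ω)).toReal := by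
    intro N
    rw [← ENNReal.ofReal_le_iff_le_toReal hω.ne,
      ENNReal.ofReal_sum_of_nonneg fun k _ => hf0 k ω]
    exact ENNReal.sum_le_tsum _
  exact ⟨summable_of_sum_range_le (fun k => hf0 k ω) hbd, hbd⟩

end Integral

section WeightedErr

variable {E Ω : Type*} [NormedAddCommGroup E] {G : E → E} {s : ℝ} {τ : ℕ} {δ : ℕ → ℝ}
  {d : ℕ → Ω → ℕ} {y Gt : ℕ → Ω → E}

/-- The weighted squared error of the `k`-th estimator. -/
noncomputable def weightedErr (G : E → E) (s : ℝ) (τ : ℕ) (d : ℕ → Ω → ℕ) (y Gt : ℕ → Ω → E)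
    (k : ℕ) (ω : Ω) : ℝ :=
  errWeight s τ k * ‖Gt k ω - G (y (k - d k ω) ω)‖ ^ 2

lemma weightedErr_nonneg (hW : ∀ k, 0 < errWeight s τ k) (k : ℕ) (ω : Ω) :
    0 ≤ weightedErr G s τ d y Gt k ω :=
  mul_nonneg (hW k).le (sq_nonneg _)

variable [MeasurableSpace E] [MeasurableSpace Ω] {P : Measure Ω}

lemma IsDelayedEstimator.integrable_weightedErr (hest : IsDelayedEstimator P G s τ δ d y Gt)
    (k : ℕ) : Integrable (weightedErr G s τ d y Gt k) P :=
  (hest.integrable_sq k).const_mul _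

lemma IsDelayedEstimator.integral_weightedErr_le (hest : IsDelayedEstimator P G s τ δ d y Gt)
    (hW : ∀ k, 0 < errWeight s τ k) (k : ℕ) : ∫ ω, weightedErr G s τ d y Gt k ω ∂P ≤ δ k := by
  unfold weightedErr
  rw [integral_const_mul]
  have := mul_le_mul_of_nonneg_left (hest.error_le k) (hW k).le
  rwa [← errWeight, mul_div_cancel₀ _ (hW k).ne'] at this

end WeightedErr

section Stochastic

variable {E Ω : Type*} [NormedAddCommGroup E] [InnerProductSpace ℝ E] [MeasurableSpace Ω]
variable {P : Measure Ω} {G : E → E} {β s γ η : ℝ} {τ : ℕ} {δ : ℕ → ℝ} {d : ℕ → Ω → ℕ}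
  {y0 : E} {Gt x y z : ℕ → Ω → E}

lemma IsAFP.admissibleRun [MeasurableSpace E] (h : IsAFP s γ η τ y0 Gt x y z)
    (hest : IsDelayedEstimator P G s τ δ d y Gt) (hγ0 : 0 < γ) (hγ1 : γ ≤ 1)
    (hs : 1 + 3 * γ ≤ s) (hβ : 0 < β) (hG : IsCoCoercive β G) (hτ : 1 ≤ τ) (hη : 0 < η)
    (hη1 : η ≤ afpEtaMax β s γ τ) (ω : Ω) :
    AdmissibleRun s γ η β τ G (fun k => d k ω) (fun k => Gt k ω) (fun k => x k ω)
      (fun k => y k ω) (fun k => z k ω) where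
  gamma_pos := hγ0
  gamma_le := hγ1
  le_s := hs
  one_le_tau := hτ
  eta_pos := hη
  eta_le := hη1
  beta_pos := hβ
  coCoercive := hG
  delay_le := fun k => hest.delay_le k ω
  z_zero := by rw [h.z_zero, h.y_zero]
  x_succ := fun k => h.x_succ k ω
  z_succ := fun k => h.z_succ k ω
  y_succ := fun k => h.y_succ k ω

lemma IsAFP.measurable [MeasurableSpace E] [BorelSpace E] [SecondCountableTopology E]
    (h : IsAFP s γ η τ y0 Gt x y z) (hGt : ∀ k, Measurable (Gt k)) (k : ℕ) :
    Measurable (y k) ∧ Measurable (z k) := by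
  induction k with
  | zero =>
    rw [show y 0 = fun _ => y0 from funext h.y_zero, show z 0 = fun _ => y0 from funext h.z_zero]
    exact ⟨measurable_const, measurable_const⟩
  | succ n ih =>
    have hx : Measurable (x (n + 1)) := by
      rw [show x (n + 1) = fun ω => y n ω - afpStep s η τ n • Gt n ω from funext (h.x_succ n)]
      exact ih.1.sub ((hGt n).const_smul _)
    have hz : Measurable (z (n + 1)) := by
      rw [show z (n + 1) = fun ω => z n ω + (γ / s) • (x (n + 1) ω - y n ω) from
        funext (h.z_succ n)]
      exact ih.2.add ((hx.sub ih.1).const_smul _)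
    refine ⟨?_, hz⟩
    rw [show y (n + 1) = fun ω => ((afpT s τ n - s) / afpT s τ n) • x (n + 1) ω +
      (s / afpT s τ n) • z (n + 1) ω from funext (h.y_succ n)]
    exact (hx.const_smul _).add (hz.const_smul _)

variable [MeasurableSpace E] [FiniteDimensional ℝ E] [BorelSpace E] [IsProbabilityMeasure P]

/-- The rate in expectation. -/
lemma IsAFP.integral_le (h : IsAFP s γ η τ y0 Gt x y z)
    (hest : IsDelayedEstimator P G s τ δ d y Gt) (hδ : Summable δ)
    (hrun : ∀ ω, AdmissibleRun s γ η β τ G (fun k => d k ω) (fun k => Gt k ω) (fun k => x k ω)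
      (fun k => y k ω) (fun k => z k ω)) {xs : E} (hxs : G xs = 0) (k : ℕ) :
    Integrable (fun ω => ‖G (y k ω)‖ ^ 2) P ∧
      ∫ ω, ‖G (y k ω)‖ ^ 2 ∂P ≤
        4 * (afpRSq G s γ η τ y0 xs + afpLambda s γ * η / τ * ∑' j, 2 * δ j) /
          (η * (k + 3 * s + τ - 1) ^ 2) := by
  obtain ⟨ω0⟩ : Nonempty Ω := nonempty_of_isProbabilityMeasure P
  have h0 := hrun ω0
  have hη := h0.eta_pos
  have hs := h0.one_lt_s
  have hτ := h0.one_le_tau'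
  have hΛ := h0.lambda_pos
  have hW := h0.errWeight_pos
  have hT : 0 < (k : ℝ) + 3 * s + τ - 1 := by
    have : (0 : ℝ) ≤ k := by positivity
    linarith
  have hc : 0 < η / 4 * (k + 3 * s + τ - 1) ^ 2 := by positivity
  set F : Ω → ℝ := fun ω => afpRSq G s γ η τ y0 xs + 2 * afpLambda s γ * η / τ *
    ∑ j ∈ Finset.range k, weightedErr G s τ d y Gt j ω with hF
  have hpt : ∀ ω, η / 4 * (k + 3 * s + τ - 1) ^ 2 * ‖G (y k ω)‖ ^ 2 ≤ F ω := by
    intro ω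
    have := (hrun ω).rate hxs k
    rwa [h.y_zero] at this
  have hFint : Integrable F P :=
    (integrable_const _).add ((integrable_finsetSum _ fun j _ =>
      hest.integrable_weightedErr j).const_mul _)
  have hmeas : AEStronglyMeasurable (fun ω => ‖G (y k ω)‖ ^ 2) P :=
    ((h0.continuous_of_run.measurable.comp (h.measurable hest.measurable k).1).norm.pow_const
      2).aestronglyMeasurable
  have hint : Integrable (fun ω => ‖G (y k ω)‖ ^ 2) P := by
    refine (hFint.const_mul (η / 4 * (k + 3 * s + τ - 1) ^ 2)⁻¹).mono' hmeas
      (Eventually.of_forall fun ω => ?_)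
    rw [Real.norm_of_nonneg (sq_nonneg _), ← div_eq_inv_mul, le_div_iff₀ hc, mul_comm]
    exact hpt ω
  refine ⟨hint, ?_⟩
  have h1 : η / 4 * (k + 3 * s + τ - 1) ^ 2 * ∫ ω, ‖G (y k ω)‖ ^ 2 ∂P ≤ ∫ ω, F ω ∂P := by
    rw [← integral_const_mul]
    exact integral_mono (hint.const_mul _) hFint hpt
  have h2 : ∫ ω, F ω ∂P ≤
      afpRSq G s γ η τ y0 xs + afpLambda s γ * η / τ * ∑' j, 2 * δ j := by
    rw [hF, integral_add (integrable_const _) ((integrable_finsetSum _ fun j _ =>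
      hest.integrable_weightedErr j).const_mul _), integral_const_mul,
      integral_finsetSum _ fun j _ => hest.integrable_weightedErr j, tsum_mul_left]
    simp only [integral_const, probReal_univ, one_smul]
    have h3 : ∑ j ∈ Finset.range k, ∫ ω, weightedErr G s τ d y Gt j ω ∂P ≤ ∑' j, δ j :=
      (Finset.sum_le_sum fun j _ => hest.integral_weightedErr_le hW j).trans
        (hδ.sum_le_tsum _ fun j _ => hest.delta_nonneg j)
    have h4 := mul_le_mul_of_nonneg_left h3
      (by positivity : 0 ≤ 2 * afpLambda s γ * η / τ)
    linear_combination h4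
  rw [le_div_iff₀ (by positivity)]
  linarith

/-- The rates in expectation and almost surely, and the almost sure convergence. -/
lemma IsAFP.ae_tendsto (h : IsAFP s γ η τ y0 Gt x y z)
    (hest : IsDelayedEstimator P G s τ δ d y Gt) (hδ : Summable δ)
    (hrun : ∀ ω, AdmissibleRun s γ η β τ G (fun k => d k ω) (fun k => Gt k ω) (fun k => x k ω)
      (fun k => y k ω) (fun k => z k ω)) {xs : E} (hxs : G xs = 0) :
    Tendsto (fun k : ℕ => ((k : ℝ) + τ) ^ 2 * ∫ ω, ‖G (y k ω)‖ ^ 2 ∂P) atTop (𝓝 0) ∧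
    (∀ᵐ ω ∂P, Summable (fun k : ℕ => ((k : ℝ) + τ) * ‖G (y k ω)‖ ^ 2) ∧
      Tendsto (fun k : ℕ => ((k : ℝ) + τ) ^ 2 * ‖G (y k ω)‖ ^ 2) atTop (𝓝 0)) ∧
    ∃ X : Ω → E, Measurable X ∧ (∀ ω, G (X ω) = 0) ∧
      ∀ᵐ ω ∂P, Tendsto (fun k => x k ω) atTop (𝓝 (X ω)) ∧
        Tendsto (fun k => y k ω) atTop (𝓝 (X ω)) ∧
        Tendsto (fun k => z k ω) atTop (𝓝 (X ω)) := by
  obtain ⟨ω0⟩ : Nonempty Ω := nonempty_of_isProbabilityMeasure P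
  have h0 := hrun ω0
  have hη := h0.eta_pos
  have hs := h0.one_lt_s
  have hΛ := h0.lambda_pos
  have hτ := h0.one_le_tau'
  have hW := h0.errWeight_pos
  have hGc := h0.continuous_of_run
  have hym : ∀ k, Measurable (y k) := fun k => (h.measurable hest.measurable k).1
  obtain ⟨S, hSint, hS⟩ := exists_integrable_bound_sum (P := P)
    (f := weightedErr G s τ d y Gt) (weightedErr_nonneg hW) hest.integrable_weightedErr
    (Summable.of_nonneg_of_le (fun k => integral_nonneg (weightedErr_nonneg hW k))
      (hest.integral_weightedErr_le hW) hδ)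
  refine ⟨?_, ?_, ?_⟩
  -- The pathwise rate, with the partial error sums replaced by S, is an integrable bound
  -- independent of k.
  · have hdom := tendsto_integral_of_dominated_convergence
      (F := fun (k : ℕ) ω => ((k : ℝ) + τ) ^ 2 * ‖G (y k ω)‖ ^ 2) (f := fun _ => 0) (μ := P)
      (fun ω => (η / 4)⁻¹ * (afpRSq G s γ η τ y0 xs + 2 * afpLambda s γ * η / τ * S ω))
      (fun k => (((hGc.measurable.comp (hym k)).norm.pow_const 2).const_mul
        _).aestronglyMeasurable)
      (((integrable_const _).add (hSint.const_mul _)).const_mul _) (fun k => ?_) ?_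
    · simpa only [integral_const_mul, integral_zero] using hdom
    · filter_upwards [hS] with ω hω
      have h1 := (hrun ω).rate hxs k
      rw [h.y_zero] at h1
      have h2 := mul_le_mul_of_nonneg_left (hω.2 k)
        (by positivity : 0 ≤ 2 * afpLambda s γ * η / τ)
      rw [Real.norm_of_nonneg (by positivity), ← div_eq_inv_mul, le_div_iff₀ (by positivity)]
      have h3 : ((k : ℝ) + τ) ^ 2 ≤ (k + 3 * s + τ - 1) ^ 2 := by
        gcongr; linarith
      have h4 := mul_le_mul_of_nonneg_right h3
        (by positivity : 0 ≤ η / 4 * ‖G (y k ω)‖ ^ 2)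
      unfold weightedErr at h2
      linarith
    · filter_upwards [hS] with ω hω
      exact (hrun ω).tendsto_rate hxs hω.1
  · filter_upwards [hS] with ω hω
    exact ⟨(hrun ω).summable_rate hxs hω.1, (hrun ω).tendsto_rate hxs hω.1⟩
  · have hlim : ∀ᵐ ω ∂P, ∃ a, G a = 0 ∧ Tendsto (fun k => x k ω) atTop (𝓝 a) ∧
        Tendsto (fun k => y k ω) atTop (𝓝 a) ∧ Tendsto (fun k => z k ω) atTop (𝓝 a) := by
      filter_upwards [hS] with ω hω
      exact (hrun ω).exists_limit hxs hω.1
    obtain ⟨f, hf, hft⟩ := measurable_limit_of_tendsto_metrizable_ae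
      (fun k => (hym k).aemeasurable) (hlim.mono fun ω ⟨a, ha⟩ => ⟨a, ha.2.2.1⟩)
    classical
    have hset : MeasurableSet {ω | G (f ω) = 0} :=
      (hGc.measurable.comp hf) (measurableSet_singleton 0)
    -- The measurable limit is a zero of G only almost everywhere; elsewhere it is reset to the
    -- fixed zero xs.
    refine ⟨fun ω => if G (f ω) = 0 then f ω else xs, Measurable.ite hset hf measurable_const,
      fun ω => ?_, ?_⟩
    · dsimp only
      split_ifs with hω
      · exact hω
      · exact hxs
    · filter_upwards [hlim, hft] with ω ⟨a, ha, hx, hy, hz⟩ hfω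
      have : f ω = a := tendsto_nhds_unique hfω hy
      rw [this, if_pos ha]
      exact ⟨hx, hy, hz⟩

end Stochastic

/-! ### Iteration complexity. -/

section Complexity

/-- The number of iterations after which the rate in expectation is below `ε²`. -/
lemma rate_le_sq {s γ β σ R M ε T n0 n1 : ℝ} {τ : ℕ} (hγ0 : 0 < γ)
    (hs : 1 + 3 * γ ≤ s) (hβ : 0 < β) (hσ : 0 ≤ σ) (hτ : 1 ≤ τ) (hM : 0 ≤ M) (hε : 0 < ε)
    (hn0 : 0 ≤ n0) (hn1 : 0 ≤ n1) (hn0R : n0 ≤ R) (hn1R : n1 ≤ R) (hT0 : 0 < T)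
    (hT : (1 + 32 * s ^ 2 * R ^ 2 + 8 * s ^ 3 / γ * ((7 * afpLambda s γ + 6) / 3) ^ 2 * R ^ 2 +
      8 * afpLambda s γ * M) * (σ / (ε * √(τ : ℝ)) + τ / ε + τ / (β * ε)) ≤ T) :
    4 * (afpEtaMax β s γ τ * (3 * s + τ - 1) ^ 2 / 2 * n0 ^ 2 +
      2 * s ^ 3 / (afpEtaMax β s γ τ * γ) * n1 ^ 2 +
      afpLambda s γ * afpEtaMax β s γ τ / τ * (2 * (σ ^ 2 * M))) /
        (afpEtaMax β s γ τ * T ^ 2) ≤ ε ^ 2 := by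
  have hs0 : 1 < s := by linarith
  have hτ' : (1 : ℝ) ≤ τ := by exact_mod_cast hτ
  have hΛ : 0 < afpLambda s γ := by unfold afpLambda; linarith
  have hη : 0 < afpEtaMax β s γ τ := by unfold afpEtaMax; positivity
  -- By τ ≥ 1, 3 + (7Λ + 3)τ ≤ (7Λ + 6)τ.
  have hηinv : (afpEtaMax β s γ τ)⁻¹ ≤ (7 * afpLambda s γ + 6) / 3 * (τ / β) := by
    unfold afpEtaMax
    rw [inv_div, div_le_iff₀ (by positivity)]
    have : (7 * afpLambda s γ + 6) / 3 * (τ / β) * (3 * β) = (7 * afpLambda s γ + 6) * τ := by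
      field_simp
    rw [this]
    linarith
  generalize afpEtaMax β s γ τ = η at *
  have hD0 : 0 < (7 * afpLambda s γ + 6) / 3 := by positivity
  generalize (7 * afpLambda s γ + 6) / 3 = D at *
  generalize afpLambda s γ = Λ at *
  obtain ⟨C, hC⟩ : ∃ C, C = 1 + 32 * s ^ 2 * R ^ 2 + 8 * s ^ 3 / γ * D ^ 2 * R ^ 2 + 8 * Λ * M :=
    ⟨_, rfl⟩
  rw [← hC] at hT
  have c1 : 0 ≤ 32 * s ^ 2 * R ^ 2 := by positivity
  have c2 : 0 ≤ 8 * s ^ 3 / γ * D ^ 2 * R ^ 2 := by positivity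
  have c3 : 0 ≤ 8 * Λ * M := by positivity
  have hC1 : 1 ≤ C := by linarith
  -- The summand 1 in the constant guarantees C ≥ 1, so no square root of the individual constants
  -- is needed.
  have hCsq : C ≤ C ^ 2 := by nlinarith
  have hsqrt : 0 < √(τ : ℝ) := Real.sqrt_pos.2 (by linarith)
  have hTε : C * (σ / √(τ : ℝ) + τ + τ / β) ≤ T * ε := by
    have := mul_le_mul_of_nonneg_right hT hε.le
    refine le_trans (le_of_eq ?_) this
    field_simp
  have hsq : C * (σ ^ 2 / τ + τ ^ 2 + (τ / β) ^ 2) ≤ (T * ε) ^ 2 := by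
    have e1 : (σ / √(τ : ℝ)) ^ 2 = σ ^ 2 / τ := by
      rw [div_pow, Real.sq_sqrt (by linarith)]
    have p1 : 0 ≤ σ / √(τ : ℝ) := by positivity
    have p2 : 0 ≤ (τ : ℝ) / β := by positivity
    calc C * (σ ^ 2 / τ + τ ^ 2 + (τ / β) ^ 2)
        ≤ C ^ 2 * (σ ^ 2 / τ + τ ^ 2 + (τ / β) ^ 2) := by gcongr
      _ ≤ C ^ 2 * (σ / √(τ : ℝ) + τ + τ / β) ^ 2 := by
          gcongr
          rw [← e1]
          have : (0 : ℝ) ≤ τ := by linarith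
          nlinarith [mul_nonneg p1 p2, mul_nonneg p1 this, mul_nonneg p2 this]
      _ = (C * (σ / √(τ : ℝ) + τ + τ / β)) ^ 2 := by ring
      _ ≤ (T * ε) ^ 2 := by gcongr
  have b1 : 2 * (3 * s + τ - 1) ^ 2 * n0 ^ 2 ≤ 32 * s ^ 2 * R ^ 2 * τ ^ 2 := by
    have : 3 * s + τ - 1 ≤ 4 * s * τ := by
      nlinarith [mul_nonneg (by linarith : 0 ≤ s - 1) (by linarith : (0 : ℝ) ≤ τ - 1)]
    have h0 : 0 ≤ 3 * s + τ - 1 := by linarith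
    calc 2 * (3 * s + τ - 1) ^ 2 * n0 ^ 2 ≤ 2 * (4 * s * τ) ^ 2 * R ^ 2 := by gcongr
      _ = _ := by ring
  have b2 : 8 * s ^ 3 / γ * (η⁻¹) ^ 2 * n1 ^ 2 ≤
      8 * s ^ 3 / γ * D ^ 2 * R ^ 2 * (τ / β) ^ 2 := by
    calc 8 * s ^ 3 / γ * (η⁻¹) ^ 2 * n1 ^ 2 ≤ 8 * s ^ 3 / γ * (D * (τ / β)) ^ 2 * R ^ 2 := by
          gcongr
      _ = _ := by ring
  have b3 : 2 * (3 * s + τ - 1) ^ 2 * n0 ^ 2 + 8 * s ^ 3 / γ * (η⁻¹) ^ 2 * n1 ^ 2 +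
      8 * Λ * M * (σ ^ 2 / τ) ≤ C * (σ ^ 2 / τ + τ ^ 2 + (τ / β) ^ 2) := by
    have q1 : 0 ≤ σ ^ 2 / (τ : ℝ) := by positivity
    have q2 : 0 ≤ (τ : ℝ) ^ 2 := by positivity
    have q3 : 0 ≤ ((τ : ℝ) / β) ^ 2 := by positivity
    have r1 : 32 * s ^ 2 * R ^ 2 * τ ^ 2 ≤ C * τ ^ 2 := by gcongr; linarith
    have r2 : 8 * s ^ 3 / γ * D ^ 2 * R ^ 2 * (τ / β) ^ 2 ≤ C * (τ / β) ^ 2 := by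
      gcongr; linarith
    have r3 : 8 * Λ * M * (σ ^ 2 / τ) ≤ C * (σ ^ 2 / τ) := by gcongr; linarith
    linarith
  rw [div_le_iff₀ (by positivity)]
  have e : 4 * (η * (3 * s + τ - 1) ^ 2 / 2 * n0 ^ 2 + 2 * s ^ 3 / (η * γ) * n1 ^ 2 +
      Λ * η / τ * (2 * (σ ^ 2 * M))) =
      η * (2 * (3 * s + τ - 1) ^ 2 * n0 ^ 2 + 8 * s ^ 3 / γ * (η⁻¹) ^ 2 * n1 ^ 2 +
        8 * Λ * M * (σ ^ 2 / τ)) := by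
    field_simp
    ring
  rw [e]
  have := mul_le_mul_of_nonneg_left (b3.trans hsq) hη.le
  linarith

end Complexity

theorem corollary2 (s γ : ℝ) (hγ0 : 0 < γ) (hγ1 : γ ≤ 1) (hs : 1 + 3 * γ ≤ s) :
    -- rates in expectation, almost sure rates, almost sure convergence
    (∀ (E : Type u) [NormedAddCommGroup E] [InnerProductSpace ℝ E] [FiniteDimensional ℝ E]
        [MeasurableSpace E] [BorelSpace E]
        (Ω : Type v) [MeasurableSpace Ω] (P : Measure Ω) [IsProbabilityMeasure P]
        (Ξ : Type w) [MeasurableSpace Ξ] (ν : Measure Ξ) [IsProbabilityMeasure ν]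
        (G : E → E) (O : E → Ξ → E) (β σ η : ℝ) (τ : ℕ) (δ : ℕ → ℝ) (d : ℕ → Ω → ℕ)
        (y0 : E) (Gt x y z : ℕ → Ω → E),
        (∃ xs, G xs = 0) → 0 < β → IsCoCoercive β G → IsUnbiasedOracle G O ν σ →
        1 ≤ τ → 0 < η → η ≤ afpEtaMax β s γ τ →
        IsAFP s γ η τ y0 Gt x y z → IsDelayedEstimator P G s τ δ d y Gt → Summable δ →
        (∀ xs, G xs = 0 → ∀ k : ℕ,
          Integrable (fun ω => ‖G (y k ω)‖ ^ 2) P ∧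
          ∫ ω, ‖G (y k ω)‖ ^ 2 ∂P ≤
            4 * (afpRSq G s γ η τ y0 xs + afpLambda s γ * η / τ * ∑' j, 2 * δ j) /
              (η * (k + 3 * s + τ - 1) ^ 2)) ∧
        Tendsto (fun k : ℕ => ((k : ℝ) + τ) ^ 2 * ∫ ω, ‖G (y k ω)‖ ^ 2 ∂P) atTop (𝓝 0) ∧
        (∀ᵐ ω ∂P, Summable (fun k : ℕ => ((k : ℝ) + τ) * ‖G (y k ω)‖ ^ 2) ∧
          Tendsto (fun k : ℕ => ((k : ℝ) + τ) ^ 2 * ‖G (y k ω)‖ ^ 2) atTop (𝓝 0)) ∧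
        ∃ X : Ω → E, Measurable X ∧ (∀ ω, G (X ω) = 0) ∧
          ∀ᵐ ω ∂P, Tendsto (fun k => x k ω) atTop (𝓝 (X ω)) ∧
            Tendsto (fun k => y k ω) atTop (𝓝 (X ω)) ∧
            Tendsto (fun k => z k ω) atTop (𝓝 (X ω))) ∧
    -- iteration complexity; the hidden constant depends on `s, γ, r, q, R` only
    (∀ r q R : ℝ, 0 < r → 0 < q → ∃ C : ℝ, 0 < C ∧
      ∀ (E : Type u) [NormedAddCommGroup E] [InnerProductSpace ℝ E] [FiniteDimensional ℝ E]
        [MeasurableSpace E] [BorelSpace E]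
        (Ω : Type v) [MeasurableSpace Ω] (P : Measure Ω) [IsProbabilityMeasure P]
        (Ξ : Type w) [MeasurableSpace Ξ] (ν : Measure Ξ) [IsProbabilityMeasure ν]
        (G : E → E) (O : E → Ξ → E) (β σ : ℝ) (τ : ℕ) (d : ℕ → Ω → ℕ)
        (y0 xs : E) (Gt x y z : ℕ → Ω → E),
        G xs = 0 → ‖y0 - xs‖ ≤ R → ‖G y0‖ ≤ R →
        0 < β → IsCoCoercive β G → IsUnbiasedOracle G O ν σ → 1 ≤ τ →
        IsAFP s γ (afpEtaMax β s γ τ) τ y0 Gt x y z →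
        IsDelayedEstimator P G s τ (fun k => σ ^ 2 / ((k : ℝ) + r) ^ (1 + q)) d y Gt →
        ∀ ε : ℝ, 0 < ε → ∃ N : ℕ,
          (N : ℝ) ≤ C * (σ / (ε * √(τ : ℝ)) + τ / ε + τ / (β * ε)) ∧
          ∀ k, N ≤ k → Integrable (fun ω => ‖G (y k ω)‖ ^ 2) P ∧
            ∫ ω, ‖G (y k ω)‖ ^ 2 ∂P ≤ ε ^ 2) := by
  refine ⟨?_, ?_⟩
  · intro E _ _ _ _ _ Ω _ P _ Ξ _ ν _ G O β σ η τ δ d y0 Gt x y z hzer hβ hG _ hτ hη hη1 hA hest hδ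
    have hrun := hA.admissibleRun hest hγ0 hγ1 hs hβ hG hτ hη hη1
    obtain ⟨xs, hxs⟩ := hzer
    exact ⟨fun xs' hxs' k => hA.integral_le hest hδ hrun hxs' k, hA.ae_tendsto hest hδ hrun hxs⟩
  · intro r q R hr hq
    have hsum : Summable fun k : ℕ => 1 / ((k : ℝ) + r) ^ (1 + q) := by
      refine ((Real.summable_one_div_nat_add_rpow r (1 + q)).2 (by linarith)).congr fun k => ?_
      rw [abs_of_pos (by positivity)]
    have hM : 0 ≤ ∑' k : ℕ, 1 / ((k : ℝ) + r) ^ (1 + q) := tsum_nonneg fun k => by positivity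
    have hs0 : 0 < s := by linarith
    have hΛ : 0 < afpLambda s γ := by unfold afpLambda; linarith
    refine ⟨1 + 32 * s ^ 2 * R ^ 2 + 8 * s ^ 3 / γ * ((7 * afpLambda s γ + 6) / 3) ^ 2 * R ^ 2 +
      8 * afpLambda s γ * ∑' k : ℕ, 1 / ((k : ℝ) + r) ^ (1 + q), by positivity, ?_⟩
    intro E _ _ _ _ _ Ω _ P _ Ξ _ ν _ G O β σ τ d y0 xs Gt x y z hxs hR1 hR0 hβ hG hO hτ hA hest
      ε hε
    have hη : 0 < afpEtaMax β s γ τ := by unfold afpEtaMax; positivity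
    have hrun := hA.admissibleRun hest hγ0 hγ1 hs hβ hG hτ hη le_rfl
    have hσ := hO.sigma_nonneg
    have hδ : Summable fun k : ℕ => σ ^ 2 / ((k : ℝ) + r) ^ (1 + q) :=
      (hsum.mul_left (σ ^ 2)).congr fun k => by rw [mul_one_div]
    have htsum : ∑' k : ℕ, 2 * (σ ^ 2 / ((k : ℝ) + r) ^ (1 + q)) =
        2 * (σ ^ 2 * ∑' k : ℕ, 1 / ((k : ℝ) + r) ^ (1 + q)) := by
      rw [tsum_mul_left, ← tsum_mul_left (a := σ ^ 2)]
      simp only [mul_one_div]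
    refine ⟨⌊_⌋₊, Nat.floor_le (by positivity), fun k hk => ?_⟩
    obtain ⟨hint, hle⟩ := hA.integral_le hest hδ hrun hxs k
    refine ⟨hint, hle.trans ?_⟩
    rw [htsum]
    have hτ' : (1 : ℝ) ≤ τ := by exact_mod_cast hτ
    have hk0 : (0 : ℝ) ≤ k := by positivity
    refine rate_le_sq hγ0 hs hβ hσ hτ hM hε (norm_nonneg _) (norm_nonneg _) hR0 hR1
      (by linarith) ?_
    -- N is the integer part of the bound, so k ≥ N gives only k + 1 ≥ bound. This suffices because
    -- the denominator has k + 3s + τ - 1 ≥ k + 1.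
    have h1 := (Nat.lt_floor_add_one _).le.trans
      (add_le_add_left (Nat.cast_le (α := ℝ).2 hk) 1)
    linarith
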